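/- Let $n\ge 0$. A graph is a connected $1$-dimensional CW complex with finitely many cells. A partition of a graph $G$ of rank $n$ (the rank of $\pi_1(G)$) is a partition of its set of edges into $n$ nonempty edge sets $h_1,\dots,h_n$ such that every nontrivial cycle of $G$ contains one of the $h_i$. An edge basis is a choice of one edge $e_i\in h_i$ for each $i$; its complement is a maximal tree, and the basic cycle $C_i$ is the unique cycle in this tree with $e_i$ added; it contains $h_i$. The partitioned graph is oriented if, for some edge basis with oriented edges, every edge of $h_i$ carries the direction in which $C_i$ runs through it when $C_i$ is directed by $e_i$ (for each $i$). A colored graph of rank $n$ is a pointed, oriented, partitioned graph whose edge sets are numbered (colored) by $1,\dots,n$ and whose vertices have valence at least $3$, except for the basepoint, which may be bivalent (for $n=0$ it is a point). An equivalence of colored graphs is a pointed cellular homeomorphism preserving colors and orientations. A blowdown is a composition of quotient maps, each collapsing an edge whose edge set has at least two elements; the collapsed graph has the induced basepoint, colors and orientation. Let $R_n$ be the colored graph of rank $n$ with one vertex, and identify the free group $F_n$ on $x_1,\dots,x_n$ with $\pi_1(R_n)$ by taking $x_i$ to the loop running once along the $i$-th edge in the positive direction. A marked, colored graph $(G,\mu)$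 is a colored graph $G$ of rank $n$ with a pointed homotopy equivalence $\mu\colon R_n\to G$. Two of them, $(G,\mu)$ and $(G',\mu')$, are equivalent if there is an equivalence $f\colon G\to G'$ of colored graphs such that $f\circ\mu$ and $\mu'$ are pointed homotopic. The equivalence classes form a poset ${\rm b}\mathcal D_n$, in which $(G',\mu')\le (G,\mu)$ if there is a blowdown $h\colon G\to G'$ such that $(G',\mu')$ is equivalent to $(G',h\circ\mu)$. Let $X_n$ be the geometric realization of the poset ${\rm b}\mathcal D_n$. Let the product $fg$ in $\mathrm{Aut}(F_n)$ be the composite "first $f$, then $g$". For $f\in \mathrm{Aut}(F_n)$ let $f'\colon R_n\to R_n$ be the pointed map, unique up to pointed homotopy, which induces $f$ on $\pi_1(R_n)=F_n$. Then $f\cdot(G,\mu)=(G,\mu\circ f')$ defines a left action of $\mathrm{Aut}(F_n)$ on ${\rm b}\mathcal D_n$ by poset isomorphisms, and hence a simplicial action on $X_n$. **Proposition.** The action of $\mathrm{Aut}(F_n)$ on $X_n$ is free: if $f\in\mathrm{Aut}(F_n)$ and $f\cdot x=x$ for some point $x\in X_n$, then $f=1$. -/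

import Mathlib

open scoped unitInterval

noncomputable section

namespace AutFree

/-! ### Graphs -/

/-- A graph: a connected one-dimensional CW complex with finitely many cells, given by its sets of
vertices and edges and the two attaching functions. Every edge is directed from `d₀` to `d₁`. -/
structure FinGraph where
  V : Type
  E : Type
  finV : Finite V
  finE : Finite E
  d₀ : E → V
  d₁ : E → V
  connected : ∀ v w : V, Relation.EqvGen (fun a b => ∃ e, d₀ e = a ∧ d₁ e = b) v w
  nonempty : Nonempty V

namespace FinGraph

variable (G : FinGraph)

/-- A directed edge is an edge with a direction of travel, `true` meaning from `d₀` to `d₁`;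
this is the vertex where the travel starts. -/
def start (a : G.E × Bool) : G.V := if a.2 then G.d₀ a.1 else G.d₁ a.1

/-- The vertex where the travel along a directed edge ends. -/
def finish (a : G.E × Bool) : G.V := if a.2 then G.d₁ a.1 else G.d₀ a.1

/-- A (nontrivial, simple) cycle with `m + 1` directed edges, indexed cyclically by `Fin (m + 1)`:
no vertex and no edge is repeated. -/
structure IsCycle {m : ℕ} (p : Fin (m + 1) → G.E × Bool) : Prop where
  closed : ∀ i, G.finish (p i) = G.start (p (i + 1))
  start_injective : Function.Injective fun i => G.start (p i)
  edge_injective : Function.Injective fun i => (p i).1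

/-- The number of half-edges incident with a vertex. -/
def valence (v : G.V) : ℕ := Nat.card {e // G.d₀ e = v} + Nat.card {e // G.d₁ e = v}

/-- The disjoint union of the cells: one point for every vertex, one interval for every edge. -/
abbrev Cells : Type := (Σ _ : G.V, Unit) ⊕ (Σ _ : G.E, I)

/-- The two ends of every edge are glued to the end points of the edge. -/
inductive Glue : G.Cells → G.Cells → Prop
  | zero (e : G.E) : Glue (.inr ⟨e, 0⟩) (.inl ⟨G.d₀ e, ()⟩)
  | one (e : G.E) : Glue (.inr ⟨e, 1⟩) (.inl ⟨G.d₁ e, ()⟩)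

/-- The topological space underlying a graph, with the quotient topology. -/
def Space : Type := Quot G.Glue

instance : TopologicalSpace G.Space := inferInstanceAs (TopologicalSpace (Quot G.Glue))

/-- A vertex as a point of the space. -/
def vertex (v : G.V) : G.Space := Quot.mk _ (.inl ⟨v, ()⟩)

/-- The characteristic map of an edge. -/
def edge (e : G.E) : C(I, G.Space) where
  toFun t := Quot.mk _ (.inr ⟨e, t⟩)
  continuous_toFun := continuous_quot_mk.comp (continuous_inr.comp continuous_sigmaMk)

variable {G}

@[simp] theorem edge_zero (e : G.E) : G.edge e 0 = G.vertex (G.d₀ e) := Quot.sound (.zero e)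

@[simp] theorem edge_one (e : G.E) : G.edge e 1 = G.vertex (G.d₁ e) := Quot.sound (.one e)

theorem space_ind {P : G.Space → Prop} (hv : ∀ v, P (G.vertex v))
    (he : ∀ e t, P (G.edge e t)) (x : G.Space) : P x := by
  induction x using Quot.ind with
  | mk a =>
    rcases a with ⟨v, u⟩ | ⟨e, t⟩
    · exact hv v
    · exact he e t

/-- Maps out of the space of a graph are given cell by cell. -/
def lift {X : Type*} [TopologicalSpace X] (fv : G.V → X) (fe : G.E → C(I, X))
    (h₀ : ∀ e, fe e 0 = fv (G.d₀ e)) (h₁ : ∀ e, fe e 1 = fv (G.d₁ e)) : C(G.Space, X) where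
  toFun := Quot.lift (Sum.elim (fun a => fv a.1) (fun a => fe a.1 a.2)) (by
    rintro _ _ (e | e)
    · exact h₀ e
    · exact h₁ e)
  continuous_toFun := continuous_quot_lift _ <| by
    refine Continuous.sumElim (continuous_sigma fun v => (continuous_const : Continuous fun _ : Unit => fv v))
      (continuous_sigma fun e => (fe e).continuous)

@[simp] theorem lift_vertex {X : Type*} [TopologicalSpace X] (fv : G.V → X) (fe : G.E → C(I, X))
    (h₀ : ∀ e, fe e 0 = fv (G.d₀ e)) (h₁ : ∀ e, fe e 1 = fv (G.d₁ e)) (v : G.V) :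
    lift fv fe h₀ h₁ (G.vertex v) = fv v := rfl

@[simp] theorem lift_edge {X : Type*} [TopologicalSpace X] (fv : G.V → X) (fe : G.E → C(I, X))
    (h₀ : ∀ e, fe e 0 = fv (G.d₀ e)) (h₁ : ∀ e, fe e 1 = fv (G.d₁ e)) (e : G.E) (t : I) :
    lift fv fe h₀ h₁ (G.edge e t) = fe e t := rfl

end FinGraph

/-! ### Partitioned and colored graphs -/

/-- A graph of rank `n` whose edges are partitioned into `n` nonempty edge sets, the `i`-th one
being `{e | color e = i}`, such that every nontrivial cycle contains one of the edge sets.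
The fundamental group of a finite connected graph is free of rank `|E| - |V| + 1`. -/
structure PartitionedGraph (n : ℕ) extends FinGraph where
  color : E → Fin n
  rank_eq : Nat.card E + 1 = Nat.card V + n
  color_surjective : Function.Surjective color
  cycle_contains : ∀ (m : ℕ) (p : Fin (m + 1) → E × Bool), toFinGraph.IsCycle p →
    ∃ i, ∀ e, color e = i → ∃ j, (p j).1 = e

namespace PartitionedGraph

variable {n : ℕ} (G : PartitionedGraph n)

/-- An edge basis: one edge from each edge set. -/
def IsEdgeBasis (b : Fin n → G.E) : Prop := ∀ i, G.color (b i) = i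

/-- The cycle `p` is a basic cycle for the color `k` and the edge basis `b`: apart from `b k` it
runs in the maximal tree complementary to `b`. -/
def IsBasicCycle (b : Fin n → G.E) (k : Fin n) {m : ℕ} (p : Fin (m + 1) → G.E × Bool) : Prop :=
  G.IsCycle p ∧ ∀ j i, i ≠ k → (p j).1 ≠ b i

/-- The directions `d₀ → d₁` of the edges are those induced by an oriented edge basis `b`:
the basic cycle of color `k`, which runs through the whole `k`-th edge set, passes through
all the edges of color `k` (one of which is `b k`) in the positive direction. -/
def IsOriented : Prop :=
  ∃ b : Fin n → G.E, G.IsEdgeBasis b ∧ ∀ k, ∃ (m : ℕ) (p : Fin (m + 1) → G.E × Bool),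
    G.IsBasicCycle b k p ∧ ∀ e, G.color e = k → ∃ j, p j = (e, true)

end PartitionedGraph

/-- A colored graph of rank `n`: a pointed, oriented, partitioned graph with edge sets numbered
by the colors. Vertices have valence at least three, but the basepoint may be bivalent. (For
`n = 0` the graph is a single point.) -/
structure ColoredGraph (n : ℕ) extends PartitionedGraph n where
  base : V
  oriented : toPartitionedGraph.IsOriented
  three_le_valence : ∀ v, v ≠ base → 3 ≤ toFinGraph.valence v
  two_le_valence : n ≠ 0 → 2 ≤ toFinGraph.valence base

namespace ColoredGraph

variable {n : ℕ}

/-- The basepoint of the space of a colored graph. -/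
def pt (G : ColoredGraph n) : G.Space := G.vertex G.base

/-- An equivalence of colored graphs: a pointed cellular homeomorphism taking each edge onto an
edge of the same color and preserving its orientation. -/
structure IsEquivalence {G H : ColoredGraph n} (h : C(G.Space, H.Space)) : Prop where
  isHomeomorph : IsHomeomorph h
  map_pt : h G.pt = H.pt
  vertices : ∃ φ : G.V ≃ H.V, ∀ v, h (G.vertex v) = H.vertex (φ v)
  edges : ∃ φ : G.E ≃ H.E, ∀ e, H.color (φ e) = G.color e ∧
    ∃ θ : I ≃o I, ∀ t, h (G.edge e t) = H.edge (φ e) (θ t)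

/-- The map `h` is (up to the names of the cells of `H`) the quotient map `G → G_e` which collapses
one edge `e` whose edge set contains at least one more edge, where `G_e` has the induced basepoint,
colors and orientation. -/
def IsCollapse {G H : ColoredGraph n} (h : C(G.Space, H.Space)) : Prop :=
  ∃ e : G.E, (∃ a, a ≠ e ∧ G.color a = G.color e) ∧
    Topology.IsQuotientMap h ∧
    (∀ x y, h x = h y ↔ x = y ∨ (x ∈ Set.range (G.edge e) ∧ y ∈ Set.range (G.edge e))) ∧
    h G.pt = H.pt ∧
    (∀ v, ∃ w, h (G.vertex v) = H.vertex w) ∧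
    ∃ β : {a : G.E // a ≠ e} ≃ H.E, ∀ a, H.color (β a) = G.color a ∧
      ∀ t, h (G.edge a t) = H.edge (β a) t

/-- Blowdowns preserving basepoints, colors and orientations: compositions of maps collapsing one
edge, up to equivalences of colored graphs. -/
inductive IsBlowdown : ∀ {G H : ColoredGraph n}, C(G.Space, H.Space) → Prop
  | equivalence {G H : ColoredGraph n} {h : C(G.Space, H.Space)} :
      IsEquivalence h → IsBlowdown h
  | collapse {G H : ColoredGraph n} {h : C(G.Space, H.Space)} : IsCollapse h → IsBlowdown h
  | comp {G H K : ColoredGraph n} {h : C(G.Space, H.Space)} {k : C(H.Space, K.Space)} :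
      IsBlowdown h → IsBlowdown k → IsBlowdown (k.comp h)

theorem IsEquivalence.id (G : ColoredGraph n) : IsEquivalence (ContinuousMap.id G.Space) where
  isHomeomorph := IsHomeomorph.id
  map_pt := rfl
  vertices := ⟨Equiv.refl _, fun _ => rfl⟩
  edges := ⟨Equiv.refl _, fun _ => ⟨rfl, OrderIso.refl _, fun _ => rfl⟩⟩

theorem IsEquivalence.comp {G H K : ColoredGraph n} {h : C(G.Space, H.Space)}
    {k : C(H.Space, K.Space)} (hk : IsEquivalence k) (hh : IsEquivalence h) :
    IsEquivalence (k.comp h) where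
  isHomeomorph := hk.isHomeomorph.comp hh.isHomeomorph
  map_pt := by simp [hh.map_pt, hk.map_pt]
  vertices := by
    obtain ⟨φ, hφ⟩ := hh.vertices
    obtain ⟨ψ, hψ⟩ := hk.vertices
    exact ⟨φ.trans ψ, fun v => by simp [hφ, hψ]⟩
  edges := by
    obtain ⟨φ, hφ⟩ := hh.edges
    obtain ⟨ψ, hψ⟩ := hk.edges
    refine ⟨φ.trans ψ, fun e => ⟨by simp [(hφ e).1, (hψ (φ e)).1], ?_⟩⟩
    obtain ⟨θ, hθ⟩ := (hφ e).2
    obtain ⟨η, hη⟩ := (hψ (φ e)).2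
    exact ⟨θ.trans η, fun t => by simp [hθ, hη]⟩

theorem IsEquivalence.exists_inverse {G H : ColoredGraph n} {h : C(G.Space, H.Space)}
    (hh : IsEquivalence h) : ∃ k : C(H.Space, G.Space), IsEquivalence k ∧
      k.comp h = ContinuousMap.id _ ∧ h.comp k = ContinuousMap.id _ := by
  let f := hh.isHomeomorph.homeomorph h
  have hf : ∀ x, f x = h x := fun _ => rfl
  have key : ∀ x y, h x = y → f.symm y = x := fun x y hxy => by
    rw [← hxy, ← hf, f.symm_apply_apply]
  refine ⟨⟨f.symm, f.symm.continuous⟩, ⟨f.symm.isHomeomorph, key _ _ hh.map_pt, ?_, ?_⟩, ?_, ?_⟩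
  · obtain ⟨φ, hφ⟩ := hh.vertices
    exact ⟨φ.symm, fun v => key _ _ (by simp [hφ])⟩
  · obtain ⟨φ, hφ⟩ := hh.edges
    refine ⟨φ.symm, fun e => ⟨?_, ?_⟩⟩
    · have := (hφ (φ.symm e)).1
      rw [← this, φ.apply_symm_apply]
    · obtain ⟨θ, hθ⟩ := (hφ (φ.symm e)).2
      exact ⟨θ.symm, fun t => key _ _ (by simp [hθ])⟩
  · ext x
    exact f.symm_apply_apply x
  · ext x
    exact f.apply_symm_apply x

theorem IsEquivalence.card_eq {G H : ColoredGraph n} {h : C(G.Space, H.Space)}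
    (hh : IsEquivalence h) : Nat.card H.E = Nat.card G.E := by
  obtain ⟨φ, -⟩ := hh.edges
  exact (Nat.card_congr φ).symm

theorem IsCollapse.card_lt {G H : ColoredGraph n} {h : C(G.Space, H.Space)}
    (hh : IsCollapse h) : Nat.card H.E < Nat.card G.E := by
  obtain ⟨e, -, -, -, -, -, φ, -⟩ := hh
  have := G.finE
  rw [← Nat.card_congr φ]
  exact Finite.card_subtype_lt (x := e) (by simp)

theorem IsBlowdown.equivalence_or_card_lt {G H : ColoredGraph n} {h : C(G.Space, H.Space)}
    (hh : IsBlowdown h) : IsEquivalence h ∨ Nat.card H.E < Nat.card G.E := by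
  induction hh with
  | equivalence h => exact .inl h
  | collapse h => exact .inr h.card_lt
  | comp _ _ h k =>
    rcases h with h | h <;> rcases k with k | k
    · exact .inl (k.comp h)
    · exact .inr (k.trans_eq h.card_eq)
    · exact .inr (k.card_eq.trans_lt h)
    · exact .inr (k.trans h)

end ColoredGraph

/-! ### Pointed homotopies -/

/-- Pointed homotopy of maps out of a space with basepoint `x`. -/
abbrev PtHomotopic {X Y : Type*} [TopologicalSpace X] [TopologicalSpace Y] (x : X)
    (f g : C(X, Y)) : Prop := f.HomotopicRel g {x}

theorem PtHomotopic.precomp {X Y Z : Type*} [TopologicalSpace X] [TopologicalSpace Y]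
    [TopologicalSpace Z] {x : X} {y : Y} {f g : C(Y, Z)} (h : PtHomotopic y f g) (k : C(X, Y))
    (hk : k x = y) : PtHomotopic x (f.comp k) (g.comp k) := by
  obtain ⟨F⟩ := h
  refine ⟨⟨F.toHomotopy.comp (ContinuousMap.Homotopy.refl k), ?_⟩⟩
  rintro t _ rfl
  have := F.prop t y rfl
  simpa [hk] using this

theorem PtHomotopic.postcomp {X Y Z : Type*} [TopologicalSpace X] [TopologicalSpace Y]
    [TopologicalSpace Z] {x : X} {f g : C(X, Y)} (h : PtHomotopic x f g) (k : C(Y, Z)) :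
    PtHomotopic x (k.comp f) (k.comp g) := h.comp_continuousMap k

/-- Pointed homotopy equivalences. -/
def IsPtHomotopyEquiv {X Y : Type*} [TopologicalSpace X] [TopologicalSpace Y] (x : X) (y : Y)
    (f : C(X, Y)) : Prop :=
  f x = y ∧ ∃ g : C(Y, X), g y = x ∧ PtHomotopic x (g.comp f) (ContinuousMap.id X) ∧
    PtHomotopic y (f.comp g) (ContinuousMap.id Y)

theorem IsPtHomotopyEquiv.comp {X Y Z : Type*} [TopologicalSpace X] [TopologicalSpace Y]
    [TopologicalSpace Z] {x : X} {y : Y} {z : Z} {g : C(Y, Z)} {f : C(X, Y)}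
    (hg : IsPtHomotopyEquiv y z g) (hf : IsPtHomotopyEquiv x y f) :
    IsPtHomotopyEquiv x z (g.comp f) := by
  obtain ⟨hg₀, g', hg', h₁, h₂⟩ := hg
  obtain ⟨hf₀, f', hf', h₃, h₄⟩ := hf
  refine ⟨by simp [hf₀, hg₀], f'.comp g', by simp [hg', hf'], ?_, ?_⟩
  · exact ((h₁.precomp f hf₀).postcomp f').trans h₃
  · exact ((h₄.precomp g' hg').postcomp g).trans h₂

/-! ### The rose -/

/-- The colored graph `R_n` with one vertex and `n` edges. -/
def rose (n : ℕ) : ColoredGraph n where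
  V := Unit
  E := Fin n
  finV := inferInstance
  finE := inferInstance
  d₀ _ := ()
  d₁ _ := ()
  connected _ _ := .refl _
  nonempty := inferInstance
  color := id
  rank_eq := by simp [add_comm]
  color_surjective := Function.surjective_id
  cycle_contains m p _ := ⟨(p 0).1, fun e he => ⟨0, he.symm⟩⟩
  base := ()
  oriented := ⟨id, fun _ => rfl, fun k => ⟨0, fun _ => (k, true),
    ⟨⟨fun _ => rfl, fun i j _ => by omega, fun i j _ => by omega⟩,
      fun _ _ h => h.symm⟩, fun e he => ⟨0, by rw [← he]; rfl⟩⟩⟩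
  three_le_valence _ h := (h rfl).elim
  two_le_valence hn := by
    simp [FinGraph.valence]
    omega

/-- The loop running once along the `i`-th edge of the rose in the positive direction. -/
def roseLoop {n : ℕ} (i : Fin n) : Path (rose n).pt (rose n).pt where
  toContinuousMap := (rose n).edge i
  source' := FinGraph.edge_zero (G := (rose n).toFinGraph) i
  target' := FinGraph.edge_one (G := (rose n).toFinGraph) i

/-- The pointed map from the rose which runs along the loop `γ i` on the `i`-th edge. -/
def roseMap {n : ℕ} {X : Type*} [TopologicalSpace X] {x : X} (γ : Fin n → Path x x) :
    C((rose n).Space, X) :=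
  FinGraph.lift (G := (rose n).toFinGraph) (fun _ => x) (fun i => (γ i).toContinuousMap)
    (fun i => (γ i).source) (fun i => (γ i).target)

/-- A loop `γ` or its inverse. -/
def signedLoop {X : Type*} [TopologicalSpace X] {x : X} (γ : Path x x) (b : Bool) : Path x x :=
  if b then γ else γ.symm

/-- The loop in the rose spelled by a word in the letters `x_i` and their inverses. -/
def wordLoop {n : ℕ} : List (Fin n × Bool) → Path (rose n).pt (rose n).pt
  | [] => Path.refl _
  | a :: w => (signedLoop (roseLoop a.1) a.2).trans (wordLoop w)

/-- The pointed self-map of the rose which induces a given endomorphism of the free group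
(identified with the fundamental group of the rose): it takes the `i`-th edge to the loop spelled
by the reduced word of the image of the generator `x_i`. -/
def roseSelfMap {n : ℕ} (f : FreeGroup (Fin n) →* FreeGroup (Fin n)) :
    C((rose n).Space, (rose n).Space) :=
  roseMap fun i => wordLoop (f (FreeGroup.of i)).toWord

theorem roseMap_congr {n : ℕ} {X : Type*} [TopologicalSpace X] {x : X} {γ δ : Fin n → Path x x}
    (h : ∀ i, (γ i).Homotopic (δ i)) : PtHomotopic (rose n).pt (roseMap γ) (roseMap δ) := by
  let F := fun i => (h i).some
  let L : C((rose n).Space, C(I, X)) := FinGraph.lift (G := (rose n).toFinGraph)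
    (fun _ => ContinuousMap.const I x)
    (fun i => ((F i).toContinuousMap.comp ⟨Prod.swap, continuous_swap⟩).curry)
    (fun i => by ext s; exact (F i).source s) (fun i => by ext s; exact (F i).target s)
  refine ⟨⟨⟨⟨fun p => L p.2 p.1, ?_⟩, ?_, ?_⟩, ?_⟩⟩
  · exact L.uncurry.continuous.comp continuous_swap
  · refine FinGraph.space_ind (fun v => rfl) fun i t => ?_
    exact (F i).apply_zero t
  · refine FinGraph.space_ind (fun v => rfl) fun i t => ?_
    exact (F i).apply_one t
  · rintro t _ rfl
    rfl

/-- The homomorphism from the free group to the fundamental group of the rose (with the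
concatenation of loops, from left to right, as product) taking generators to the loops. -/
def roseHom (n : ℕ) : FreeGroup (Fin n) →* (FundamentalGroup (rose n).Space (rose n).pt)ᵐᵒᵖ :=
  FreeGroup.lift fun i => .op (FundamentalGroup.fromPath (Path.Homotopic.Quotient.mk (roseLoop i)))

theorem roseHom_mk {n : ℕ} (w : List (Fin n × Bool)) : roseHom n (FreeGroup.mk w) =
    .op (FundamentalGroup.fromPath (Path.Homotopic.Quotient.mk (wordLoop w))) := by
  induction w with
  | nil => exact map_one _
  | cons a w ih =>
    have h : FreeGroup.mk (a :: w) = FreeGroup.mk [a] * FreeGroup.mk w := by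
      simp [FreeGroup.mul_mk]
    rw [h, map_mul, ih]
    obtain ⟨i, _ | _⟩ := a
    · have h' : FreeGroup.mk [(i, false)] = (FreeGroup.of i)⁻¹ := by
        simp [FreeGroup.of, FreeGroup.inv_mk, FreeGroup.invRev]
      rw [h', map_inv, roseHom, FreeGroup.lift_apply_of]
      rfl
    · change roseHom n (FreeGroup.of i) * _ = _
      rw [roseHom, FreeGroup.lift_apply_of]
      rfl

theorem roseHom_apply {n : ℕ} (g : FreeGroup (Fin n)) : roseHom n g =
    .op (FundamentalGroup.fromPath (Path.Homotopic.Quotient.mk (wordLoop g.toWord))) := by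
  rw [← roseHom_mk, FreeGroup.mk_toWord]

/-- `roseSelfMap f` induces `f` on fundamental groups. -/
theorem map_roseHom {n : ℕ} (f : FreeGroup (Fin n) →* FreeGroup (Fin n)) (g : FreeGroup (Fin n)) :
    MulOpposite.op (FundamentalGroup.map (roseSelfMap f) (rose n).pt (roseHom n g).unop) =
      roseHom n (f g) := by
  let M : FundamentalGroup (rose n).Space (rose n).pt →*
    FundamentalGroup (rose n).Space (rose n).pt := FundamentalGroup.map (roseSelfMap f) (rose n).pt
  have : (MonoidHom.op M).comp (roseHom n) = (roseHom n).comp f := by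
    ext i
    rw [MonoidHom.comp_apply, MonoidHom.comp_apply, roseHom_apply (f _), roseHom,
      FreeGroup.lift_apply_of]
    rfl
  exact DFunLike.congr_fun this g

theorem roseSelfMap_pt {n : ℕ} (f : FreeGroup (Fin n) →* FreeGroup (Fin n)) :
    roseSelfMap f (rose n).pt = (rose n).pt := rfl

theorem roseSelfMap_comp {n : ℕ} (f g : FreeGroup (Fin n) →* FreeGroup (Fin n)) :
    PtHomotopic (rose n).pt ((roseSelfMap f).comp (roseSelfMap g)) (roseSelfMap (f.comp g)) := by
  have h : (roseSelfMap f).comp (roseSelfMap g) =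
      roseMap fun i => (wordLoop (g (FreeGroup.of i)).toWord).map (roseSelfMap f).continuous := by
    ext x
    induction x using FinGraph.space_ind <;> rfl
  rw [h]
  refine roseMap_congr fun i => ?_
  have h := map_roseHom f (g (FreeGroup.of i))
  rw [roseHom_apply, roseHom_apply] at h
  exact Path.Homotopic.Quotient.exact (MulOpposite.op_injective h)

theorem roseSelfMap_id (n : ℕ) : PtHomotopic (rose n).pt
    (roseSelfMap (MonoidHom.id (FreeGroup (Fin n)))) (ContinuousMap.id _) := by
  have h : ContinuousMap.id (rose n).Space = roseMap fun i => roseLoop i := by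
    ext x
    induction x using FinGraph.space_ind <;> rfl
  rw [h]
  refine roseMap_congr fun i => ?_
  have h := roseHom_apply (FreeGroup.of i)
  rw [roseHom, FreeGroup.lift_apply_of] at h
  exact (Path.Homotopic.Quotient.exact (MulOpposite.op_injective h)).symm

theorem roseSelfMap_isPtHomotopyEquiv {n : ℕ} (f : MulAut (FreeGroup (Fin n))) :
    IsPtHomotopyEquiv (rose n).pt (rose n).pt (roseSelfMap f.toMonoidHom) := by
  refine ⟨rfl, roseSelfMap f.symm.toMonoidHom, rfl, ?_, ?_⟩
  · have h := roseSelfMap_comp f.symm.toMonoidHom f.toMonoidHom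
    have hf : f.symm.toMonoidHom.comp f.toMonoidHom = MonoidHom.id _ := by
      ext1 i
      simp
    rw [hf] at h
    exact h.trans (roseSelfMap_id n)
  · have h := roseSelfMap_comp f.toMonoidHom f.symm.toMonoidHom
    have hf : f.toMonoidHom.comp f.symm.toMonoidHom = MonoidHom.id _ := by
      ext1 i
      simp
    rw [hf] at h
    exact h.trans (roseSelfMap_id n)

/-! ### Marked colored graphs -/

/-- A marked, colored graph of rank `n`. -/
structure MarkedGraph (n : ℕ) where
  graph : ColoredGraph n
  marking : C((rose n).Space, graph.Space)
  isPtHomotopyEquiv : IsPtHomotopyEquiv (rose n).pt graph.pt marking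

namespace MarkedGraph

variable {n : ℕ}

/-- Equivalence of marked, colored graphs: an equivalence of colored graphs compatible with the
markings up to pointed homotopy. -/
def Equivalent (a b : MarkedGraph n) : Prop :=
  ∃ h : C(a.graph.Space, b.graph.Space), ColoredGraph.IsEquivalence h ∧
    PtHomotopic (rose n).pt (h.comp a.marking) b.marking

instance setoid (n : ℕ) : Setoid (MarkedGraph n) where
  r := Equivalent
  iseqv := by
    refine ⟨fun a => ⟨_, ColoredGraph.IsEquivalence.id _, .refl _⟩, ?_, ?_⟩
    · rintro a b ⟨h, hh, hab⟩
      obtain ⟨k, hk, hkh, -⟩ := hh.exists_inverse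
      refine ⟨k, hk, ?_⟩
      have := hab.postcomp k
      rw [← ContinuousMap.comp_assoc, hkh, ContinuousMap.id_comp] at this
      exact this.symm
    · rintro a b c ⟨h, hh, hab⟩ ⟨k, hk, hbc⟩
      exact ⟨k.comp h, hk.comp hh, (hab.postcomp k).trans hbc⟩

/-- `b` is a blowdown of `a`. (Blowdown maps may end in an equivalence of colored graphs, so this
says that `b` is equivalent to the target of a blowdown `h` of `a`, with the marking `h ∘ μ`.) -/
def IsBlowdownOf (b a : MarkedGraph n) : Prop :=
  ∃ h : C(a.graph.Space, b.graph.Space), ColoredGraph.IsBlowdown h ∧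
    PtHomotopic (rose n).pt (h.comp a.marking) b.marking

theorem Equivalent.isBlowdownOf {a b : MarkedGraph n} (h : a.Equivalent b) : b.IsBlowdownOf a := by
  obtain ⟨h, hh, hab⟩ := h
  exact ⟨h, .equivalence hh, hab⟩

theorem IsBlowdownOf.trans {a b c : MarkedGraph n} (h : c.IsBlowdownOf b) (k : b.IsBlowdownOf a) :
    c.IsBlowdownOf a := by
  obtain ⟨h, hh, hbc⟩ := h
  obtain ⟨k, hk, hab⟩ := k
  exact ⟨h.comp k, .comp hk hh, (hab.postcomp h).trans hbc⟩

theorem IsBlowdownOf.antisymm {a b : MarkedGraph n} (h : b.IsBlowdownOf a)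
    (k : a.IsBlowdownOf b) : a.Equivalent b := by
  obtain ⟨h, hh, hab⟩ := h
  obtain ⟨k, hk, -⟩ := k
  rcases hh.equivalence_or_card_lt with hh | hh
  · exact ⟨h, hh, hab⟩
  · rcases hk.equivalence_or_card_lt with hk | hk
    · exact absurd hk.card_eq hh.ne'
    · exact absurd hk hh.not_gt

/-- Precomposition of the marking with the self-map of the rose given by an automorphism. -/
def precomp (a : MarkedGraph n) (f : MulAut (FreeGroup (Fin n))) : MarkedGraph n where
  graph := a.graph
  marking := a.marking.comp (roseSelfMap f.toMonoidHom)
  isPtHomotopyEquiv := a.isPtHomotopyEquiv.comp (roseSelfMap_isPtHomotopyEquiv f)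

end MarkedGraph

/-- The poset `bD_n` of equivalence classes of marked, colored graphs of rank `n`. -/
def MarkedGraphPoset (n : ℕ) : Type 1 := Quotient (MarkedGraph.setoid n)

/-- Blowdowns are smaller. -/
instance (n : ℕ) : PartialOrder (MarkedGraphPoset n) where
  le := Quotient.lift₂ MarkedGraph.IsBlowdownOf (by
    intro a b a' b' h k
    have h' : a'.Equivalent a := Setoid.symm h
    have k' : b'.Equivalent b := Setoid.symm k
    have h : a.Equivalent a' := h
    have k : b.Equivalent b' := k
    exact propext ⟨fun H => h.isBlowdownOf.trans (H.trans k'.isBlowdownOf),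
      fun H => h'.isBlowdownOf.trans (H.trans k.isBlowdownOf)⟩)
  le_refl := by
    rintro ⟨a⟩
    exact MarkedGraph.Equivalent.isBlowdownOf (Setoid.refl a)
  le_trans := by
    rintro ⟨a⟩ ⟨b⟩ ⟨c⟩ h k
    exact MarkedGraph.IsBlowdownOf.trans h k
  le_antisymm := by
    rintro ⟨a⟩ ⟨b⟩ h k
    exact Quotient.sound (MarkedGraph.IsBlowdownOf.antisymm k h)

/-- The group of automorphisms of the free group on `x_1, …, x_n`, where the product `f g` is the
composite "first `f`, then `g`" (the opposite of the convention for `MulAut`). -/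
abbrev AutFreeGroup (n : ℕ) : Type := (MulAut (FreeGroup (Fin n)))ᵐᵒᵖ

/-- The left action on marked, colored graphs: `f • (G, μ)` has the marking "first the self-map of
the rose given by `f`, then `μ`". -/
instance (n : ℕ) : MulAction (AutFreeGroup n) (MarkedGraphPoset n) where
  smul f := Quotient.map (fun a => a.precomp f.unop) (by
    rintro a b ⟨h, hh, hab⟩
    exact ⟨h, hh, PtHomotopic.precomp hab _ (roseSelfMap_pt _)⟩)
  one_smul := by
    rintro ⟨a⟩
    refine Quotient.sound ⟨_, ColoredGraph.IsEquivalence.id _, ?_⟩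
    exact (roseSelfMap_id n).postcomp a.marking
  mul_smul := by
    rintro f g ⟨a⟩
    refine Quotient.sound ⟨_, ColoredGraph.IsEquivalence.id _, ?_⟩
    exact ((roseSelfMap_comp g.unop.toMonoidHom f.unop.toMonoidHom).postcomp a.marking).symm

instance (n : ℕ) : CovariantClass (AutFreeGroup n) (MarkedGraphPoset n) (· • ·) (· ≤ ·) where
  elim := by
    rintro f ⟨a⟩ ⟨b⟩ ⟨h, hh, hab⟩
    exact ⟨h, hh, PtHomotopic.precomp hab _ (roseSelfMap_pt _)⟩

/-! ### The geometric realization of a poset -/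

/-- The points of the geometric realization of a poset: formal convex combinations
(barycentric coordinates) of the elements of a finite chain. -/
@[ext] structure Realization (P : Type*) [PartialOrder P] where
  weight : P →₀ ℝ
  nonneg : ∀ p, 0 ≤ weight p
  sum_eq_one : (weight.sum fun _ a => a) = 1
  isChain : IsChain (· ≤ ·) (weight.support : Set P)

namespace Realization

variable {P : Type*} [PartialOrder P]

/-- The characteristic map of the simplex spanned by a finite chain. -/
def simplex (s : Finset P) (hs : IsChain (· ≤ ·) (s : Set P)) (t : stdSimplex ℝ s) :
    Realization P where
  weight := (Finsupp.equivFunOnFinite.symm t.1).embDomain (Function.Embedding.subtype (· ∈ s))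
  nonneg p := by
    by_cases hp : p ∈ s
    · have := Finsupp.embDomain_apply_self (Function.Embedding.subtype (· ∈ s))
        (Finsupp.equivFunOnFinite.symm t.1) ⟨p, hp⟩
      simp only [Function.Embedding.subtype_apply] at this
      rw [this]
      exact t.2.1 _
    · rw [Finsupp.embDomain_of_notMem_range]
      simpa using hp
  sum_eq_one := by
    rw [Finsupp.sum_embDomain, Finsupp.sum_fintype _ _ (fun _ => rfl)]
    exact t.2.2
  isChain := by
    refine hs.mono ?_
    intro p hp
    rw [Finsupp.support_embDomain] at hp
    obtain ⟨q, -, rfl⟩ := Finset.mem_map.1 hp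
    exact q.2

/-- The weak topology: a set is open if and only if its preimage in every closed simplex is. -/
instance : TopologicalSpace (Realization P) :=
  ⨆ s : {s : Finset P // IsChain (· ≤ ·) (s : Set P)},
    TopologicalSpace.coinduced (simplex s.1 s.2) inferInstance

variable {M : Type*} [Group M] [MulAction M P] [CovariantClass M P (· • ·) (· ≤ ·)]

/-- A group acting on a poset by poset automorphisms acts simplicially on its realization. -/
instance : MulAction M (Realization P) where
  smul g x :=
    { weight := x.weight.equivMapDomain (MulAction.toPerm g)
      nonneg := fun p => x.nonneg _
      sum_eq_one := by
        rw [Finsupp.equivMapDomain_eq_mapDomain, Finsupp.sum_mapDomain_index_inj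
          (MulAction.toPerm g).injective]
        exact x.sum_eq_one
      isChain := by
        intro p hp q hq _
        have hp' : (g⁻¹ • p) ∈ (x.weight.support : Set P) := by
          simpa [Finsupp.mem_support_iff] using hp
        have hq' : (g⁻¹ • q) ∈ (x.weight.support : Set P) := by
          simpa [Finsupp.mem_support_iff] using hq
        have key : ∀ {a b : P}, g⁻¹ • a ≤ g⁻¹ • b → a ≤ b := fun {a b} h => by
          have := CovariantClass.elim (μ := ((· • ·) : M → P → P)) (r := (· ≤ ·)) g h
          simpa using this
        exact (x.isChain.total hp' hq').imp key key }
  one_smul x := by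
    ext p
    change x.weight ((1 : M)⁻¹ • p) = x.weight p
    simp
  mul_smul g h x := by
    ext p
    change x.weight ((g * h)⁻¹ • p) = x.weight (h⁻¹ • g⁻¹ • p)
    simp [mul_smul]

theorem smul_weight (g : M) (x : Realization P) (p : P) :
    (g • x).weight p = x.weight (g⁻¹ • p) := rfl

theorem simplex_weight (s : Finset P) (hs : IsChain (· ≤ ·) (s : Set P)) (t : stdSimplex ℝ s)
    (p : s) : (simplex s hs t).weight p = t.1 p :=
  Finsupp.embDomain_apply_self (Function.Embedding.subtype (· ∈ s)) _ p

theorem simplex_weight_of_notMem (s : Finset P) (hs : IsChain (· ≤ ·) (s : Set P))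
    (t : stdSimplex ℝ s) {p : P} (hp : p ∉ s) : (simplex s hs t).weight p = 0 :=
  Finsupp.embDomain_of_notMem_range _ _ _ (by simpa using hp)

theorem continuous_simplex (s : Finset P) (hs : IsChain (· ≤ ·) (s : Set P)) :
    Continuous (simplex s hs) :=
  continuous_iSup_rng (i := ⟨s, hs⟩) continuous_coinduced_rng

/-- The group acts by homeomorphisms of the realization. -/
instance : ContinuousConstSMul M (Realization P) where
  continuous_const_smul g := by
    refine continuous_iSup_dom.2 fun ⟨s, hs⟩ => continuous_coinduced_dom.2 ?_
    let e : s ≃ s.map (MulAction.toPerm g).toEmbedding :=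
      (MulAction.toPerm g).subtypeEquiv fun p => by simp
    have hs' : IsChain (· ≤ ·) (s.map (MulAction.toPerm g).toEmbedding : Set P) := by
      intro p hp q hq _
      obtain ⟨p, hp', rfl⟩ := Finset.mem_map.1 (Finset.mem_coe.1 hp)
      obtain ⟨q, hq', rfl⟩ := Finset.mem_map.1 (Finset.mem_coe.1 hq)
      exact (hs.total hp' hq').imp
        (CovariantClass.elim (μ := ((· • ·) : M → P → P)) (r := (· ≤ ·)) g)
        (CovariantClass.elim (μ := ((· • ·) : M → P → P)) (r := (· ≤ ·)) g)
    let r : stdSimplex ℝ s → stdSimplex ℝ (s.map (MulAction.toPerm g).toEmbedding) := fun t =>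
      ⟨fun q => t.1 (e.symm q), fun q => t.2.1 _, (Equiv.sum_comp e.symm t.1).trans t.2.2⟩
    have hr : Continuous r := by
      refine Continuous.subtype_mk (continuous_pi fun q => ?_) _
      exact (continuous_apply (e.symm q)).comp continuous_subtype_val
    have h : (fun x => g • x) ∘ simplex s hs = simplex _ hs' ∘ r := by
      funext t
      ext p
      change (simplex s hs t).weight (g⁻¹ • p) = (simplex _ hs' (r t)).weight p
      by_cases hp : g⁻¹ • p ∈ s
      · have hq : (e ⟨g⁻¹ • p, hp⟩ : P) = p := by
          change g • g⁻¹ • p = p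
          simp
        have h₁ := simplex_weight s hs t ⟨g⁻¹ • p, hp⟩
        have h₂ := simplex_weight _ hs' (r t) (e ⟨g⁻¹ • p, hp⟩)
        rw [hq] at h₂
        rw [h₁, h₂]
        exact congrArg t.1 (e.symm_apply_apply _).symm
      · rw [simplex_weight_of_notMem _ _ _ hp, simplex_weight_of_notMem]
        intro hq
        obtain ⟨q, hq, rfl⟩ := Finset.mem_map.1 hq
        exact hp (by simpa using hq)
    rw [h]
    exact (continuous_simplex _ hs').comp hr

end Realization

/-- The complex `X_n`. -/
abbrev XComplex (n : ℕ) : Type 1 := Realization (MarkedGraphPoset n)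

end AutFree

end

noncomputable section

/-! A fixed point of the realization has finite support, a chain on which `f` acts preserving order;
a minimal element is comparable with its images, so it is fixed. Thus `f` fixes the class of some
marked graph `(G, μ)`, and there is a self-equivalence `h` of the colored graph `G` with `h ∘ μ ∘
f'` homotopic to `μ`.

The core is rigidity: `h` preserves every cell with its direction (`IsColorAut.edge_eq`), hence is
homotopic to the identity by straight lines on each edge. Cancelling `μ` with a homotopy inverse
leaves `f'` homotopic to the identity, and `f = 1` because homotopic word loops in the rose spell
the same group element (`mk_eq_of_homotopic`). The latter is shown by lifting words to an explicit
covering of the rose with fibre the free group.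

Rigidity is proved by chains modulo two. The support of a nonzero closed chain contains a cycle,
hence a whole edge set (`exists_forall_ne_zero`). This forces every nonempty set `U` of colors to
contain one, `k`, whose edges lie on no basic cycle of another color in `U` (`exists_source`).
Removing such colors one at a time from the set of all colors, the edges of the removed color `k`
are seen to be fixed: modulo the remaining colors they have pairwise different starting points on
the directed basic cycle of `k` (`eq_of_joinedIn`), and connectedness to the fixed basepoint,
through edges already known to be fixed, prevents a rotation of this cycle (`fixes_color`). -/

namespace AutFree

/-! ### A covering of the rose with fibre the free group -/

section Covering

open Topology Filter

variable {n : ℕ}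

/-- The real function on the rose which is `g` on the edge `i` and vanishes elsewhere. -/
def bump (i : Fin n) (g : C(I, ℝ)) (h₀ : g 0 = 0) (h₁ : g 1 = 0) : C((rose n).Space, ℝ) :=
  FinGraph.lift (G := (rose n).toFinGraph) (fun _ => 0) (fun j : Fin n => if j = i then g else 0)
    (fun j : Fin n => by split_ifs <;> simp [h₀])
    (fun j : Fin n => by split_ifs <;> simp [h₁])

/-- The function `t (1 - t)` on the edge `i`. -/
def hump (i : Fin n) : C((rose n).Space, ℝ) :=
  bump i ⟨fun t => t * (1 - t), by fun_prop⟩ (by simp) (by simp)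

/-- The function `t (1 - t) (2 t - 1)` on the edge `i`, which is negative on the first half and
positive on the second half of this edge. -/
def wave (i : Fin n) : C((rose n).Space, ℝ) :=
  bump i ⟨fun t => t * (1 - t) * (2 * t - 1), by fun_prop⟩ (by simp) (by simp)

theorem hump_vertex (i : Fin n) : hump i (rose n).pt = 0 := rfl

theorem hump_edge (i j : Fin n) (t : I) :
    hump i ((rose n).edge j t) = if j = i then (t * (1 - t) : ℝ) else 0 := by
  change (if j = i then (_ : C(I, ℝ)) else 0) t = _
  split_ifs <;> rfl

theorem wave_edge (i j : Fin n) (t : I) :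
    wave i ((rose n).edge j t) = if j = i then (t * (1 - t) * (2 * t - 1) : ℝ) else 0 := by
  change (if j = i then (_ : C(I, ℝ)) else 0) t = _
  split_ifs <;> rfl

theorem rose_space_ind {P : (rose n).Space → Prop} (hv : P (rose n).pt)
    (he : ∀ (i : Fin n) (t : I), P ((rose n).edge i t)) (x : (rose n).Space) : P x :=
  FinGraph.space_ind (G := (rose n).toFinGraph) (fun _ => hv) he x

/-- Distinct edges meet only at the vertex, where every wave vanishes. This makes the choice in
`side` unambiguous. -/
theorem wave_unique {i j : Fin n} {x : (rose n).Space} (hi : wave i x ≠ 0) (hj : wave j x ≠ 0) :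
    i = j := by
  induction x using rose_space_ind with
  | hv => exact (hi rfl).elim
  | he k t =>
    rw [wave_edge] at hi hj
    by_cases h : k = i
    · by_cases h' : k = j
      · exact h.symm.trans h'
      · simp [h'] at hj
    · simp [h] at hi

open Classical in
/-- The generator `x_i` on the second half of the edge `i`, and `1` elsewhere. -/
def side (x : (rose n).Space) : FreeGroup (Fin n) :=
  if h : ∃ i, 0 < wave i x then FreeGroup.of h.choose else 1

theorem side_of_pos {i : Fin n} {x : (rose n).Space} (h : 0 < wave i x) :
    side x = FreeGroup.of i := by
  have h' : ∃ i, 0 < wave i x := ⟨i, h⟩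
  rw [side, dif_pos h', wave_unique h'.choose_spec.ne' h.ne']

theorem side_of_neg {i : Fin n} {x : (rose n).Space} (h : wave i x < 0) : side x = 1 := by
  rw [side, dif_neg]
  rintro ⟨j, hj⟩
  obtain rfl := wave_unique hj.ne' h.ne
  exact hj.not_gt h

/-- The two charts: the complement of the midpoints of the edges, and the complement of the
vertex. -/
def chart : Bool → Set (rose n).Space
  | true => {x | ∀ i, hump i x ≠ 1 / 4}
  | false => {x | ∃ i, hump i x ≠ 0}

theorem isOpen_chart (b : Bool) : IsOpen (chart (n := n) b) := by
  cases b
  · have : chart (n := n) false = ⋃ i, {x | hump i x ≠ 0} := by ext; simp [chart]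
    rw [this]
    exact isOpen_iUnion fun i => isOpen_ne.preimage (hump i).continuous
  · have : chart (n := n) true = ⋂ i, {x | hump i x ≠ 1 / 4} := by ext; simp [chart]
    rw [this]
    exact isOpen_iInter_of_finite fun i => isOpen_ne.preimage (hump i).continuous

/-- On the interior of an edge the wave vanishes only at the midpoint, where the hump takes the
excluded value `1 / 4`. The overlap of the charts thus consists of open half edges. -/
theorem exists_wave_ne_zero {x : (rose n).Space} (h : x ∈ chart true) (h' : x ∈ chart false) :
    ∃ i, wave i x ≠ 0 := by
  induction x using rose_space_ind with
  | hv => exact (h'.choose_spec rfl).elim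
  | he k t =>
    refine ⟨k, ?_⟩
    have h₁ := h k
    obtain ⟨j, hj⟩ := h'
    rw [hump_edge] at h₁ hj
    obtain rfl : k = j := by
      by_contra hkj
      simp [hkj] at hj
    rw [if_pos rfl] at h₁ hj
    rw [wave_edge, if_pos rfl]
    refine mul_ne_zero hj fun h => h₁ ?_
    have : (t : ℝ) = 1 / 2 := by linarith
    rw [this]
    norm_num

/-- The only possible jumps of `side`, at the midpoints and at the vertex, are outside the overlap
of the charts. -/
theorem side_eventually_eq {x : (rose n).Space} (h : x ∈ chart true) (h' : x ∈ chart false) :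
    ∀ᶠ y in 𝓝 x, side y = side x := by
  obtain ⟨i, hi⟩ := exists_wave_ne_zero h h'
  rcases hi.lt_or_gt with hi | hi
  · filter_upwards [(isOpen_Iio.preimage (wave i).continuous).mem_nhds hi] with y hy
    rw [side_of_neg hi, side_of_neg hy]
  · filter_upwards [(isOpen_Ioi.preimage (wave i).continuous).mem_nhds hi] with y hy
    rw [side_of_pos hi, side_of_pos hy]

/-- The cochain whose coboundary is the transition function of the covering. -/
def cochain : Bool → (rose n).Space → FreeGroup (Fin n)
  | true => side
  | false => 1

instance : TopologicalSpace (FreeGroup (Fin n)) := ⊥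

instance : DiscreteTopology (FreeGroup (Fin n)) := ⟨rfl⟩

open Classical in
/-- The universal covering of the rose, glued from two charts. -/
def roseCover (n : ℕ) : FiberBundleCore Bool (rose n).Space (FreeGroup (Fin n)) where
  baseSet := chart
  isOpen_baseSet := isOpen_chart
  -- All humps vanish only at the vertex: fibre coordinates are read in the chart `true` there and
  -- in the chart `false` everywhere else.
  indexAt x := decide (∀ i, hump i x = 0)
  mem_baseSet_at x := by
    by_cases h : ∀ i, hump i x = 0
    · rw [decide_eq_true h]
      intro i
      rw [h i]
      norm_num
    · rw [decide_eq_false h]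
      exact not_forall.1 h
  -- Being a pointwise coboundary, this satisfies the cocycle condition automatically. The covering
  -- can still be nontrivial, because `side` need not be continuous on the whole chart `true`.
  coordChange i j x v := v * ((cochain i x)⁻¹ * cochain j x)
  coordChange_self i x _ v := by simp
  continuousOn_coordChange i j := by
    rintro ⟨x, v⟩ ⟨hx, -⟩
    refine ContinuousAt.continuousWithinAt ?_
    have key : ∀ᶠ y in 𝓝 x, (cochain i y)⁻¹ * cochain j y = (cochain i x)⁻¹ * cochain j x := by
      cases i <;> cases j
      · simp
      · filter_upwards [side_eventually_eq hx.2 hx.1] with y hy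
        simp [cochain, hy]
      · filter_upwards [side_eventually_eq hx.1 hx.2] with y hy
        simp [cochain, hy]
      · simp
    have h : ContinuousAt (fun p : (rose n).Space × FreeGroup (Fin n) =>
        p.2 * ((cochain i x)⁻¹ * cochain j x)) (x, v) :=
      (continuous_of_discreteTopology
        (f := fun v : FreeGroup (Fin n) => v * ((cochain i x)⁻¹ * cochain j x))).continuousAt.comp
          continuousAt_snd
    refine h.congr ?_
    filter_upwards [continuousAt_fst.eventually key] with p hp
    rw [hp]
  coordChange_comp i j k x _ v := by group

theorem roseCover_isCoveringMap (n : ℕ) : IsCoveringMap (roseCover n).proj :=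
  FiberBundle.isCoveringMap (F := FreeGroup (Fin n)) (E := (roseCover n).Fiber)

/-! ### Lifting edges and words to the covering -/

/-- The point of the fibre over the vertex given by an element of the free group. -/
def sheet (g : FreeGroup (Fin n)) : (roseCover n).TotalSpace := ⟨(rose n).pt, g⟩

theorem mk_congr {x y : (rose n).Space} {a b : FreeGroup (Fin n)} (h : x = y) (h' : a = b) :
    (⟨x, a⟩ : (roseCover n).TotalSpace) = ⟨y, b⟩ := by
  subst h h'
  rfl

theorem sheet_injective : Function.Injective (sheet (n := n)) := fun a b h => by
  exact eq_of_heq (Bundle.TotalSpace.mk.inj h).2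

theorem hump_edge_pos (i : Fin n) {t : I} (h₀ : 0 < t) (h₁ : t < 1) :
    0 < hump i ((rose n).edge i t) := by
  rw [hump_edge, if_pos rfl]
  exact mul_pos h₀ (sub_pos.2 h₁)

theorem roseCover_indexAt_edge (i : Fin n) {t : I} (h₀ : 0 < t) (h₁ : t < 1) :
    (roseCover n).indexAt ((rose n).edge i t) = false :=
  decide_eq_false fun h => (hump_edge_pos i h₀ h₁).ne' (h i)

theorem roseCover_indexAt_pt : (roseCover n).indexAt (rose n).pt = true :=
  decide_eq_true fun _ => rfl

open Classical in
/-- The lift of the edge `i` of the rose which starts in the sheet `g`. -/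
def liftEdge (i : Fin n) (g : FreeGroup (Fin n)) (t : I) : (roseCover n).TotalSpace :=
  -- The value at `t = 1` is read in the chart of the vertex, whose coordinate on the second half of
  -- the edge differs from that of the edge chart by the factor `x_i`.
  ⟨(rose n).edge i t, if t < 1 then g else g * FreeGroup.of i⟩

theorem rose_edge_zero (i : Fin n) : (rose n).edge i 0 = (rose n).pt :=
  FinGraph.edge_zero (G := (rose n).toFinGraph) i

theorem rose_edge_one (i : Fin n) : (rose n).edge i 1 = (rose n).pt :=
  FinGraph.edge_one (G := (rose n).toFinGraph) i

/-- A criterion for continuity: near `t` the lift has the constant coordinate `a` in the chart `b`,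
as the transition from `b` to the preferred chart shows. -/
theorem continuousAt_liftEdge {i : Fin n} {g : FreeGroup (Fin n)} {t : I} (b : Bool)
    (ht : (rose n).edge i t ∈ chart b) (a : FreeGroup (Fin n))
    (h : ∀ᶠ s in 𝓝 t, (if s < 1 then g else g * FreeGroup.of i) = a * ((cochain b ((rose n).edge i s))⁻¹ *
        cochain ((roseCover n).indexAt ((rose n).edge i s)) ((rose n).edge i s))) :
    ContinuousAt (liftEdge i g) t := by
  let T := (roseCover n).localTriv b
  have hT : ContinuousAt (fun s => T.toOpenPartialHomeomorph.symm ((rose n).edge i s, a)) t := by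
    refine ContinuousAt.comp (f := fun s => ((rose n).edge i s, a)) (x := t)
      (T.toOpenPartialHomeomorph.continuousAt_symm ?_) ?_
    · exact ⟨ht, trivial⟩
    · exact (((rose n).edge i).continuous.prodMk continuous_const).continuousAt
  refine hT.congr ?_
  filter_upwards [h] with s hs
  rw [liftEdge, FiberBundleCore.localTriv_symm_apply]
  exact congrArg (Bundle.TotalSpace.mk _) hs.symm

theorem continuous_liftEdge (i : Fin n) (g : FreeGroup (Fin n)) : Continuous (liftEdge i g) := by
  refine continuous_iff_continuousAt.2 fun t => ?_
  have hpt : (rose n).pt ∈ chart true := fun j => by rw [hump_vertex]; norm_num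
  rcases t.2.1.eq_or_lt with h₀ | h₀
  · obtain rfl : t = 0 := Subtype.ext h₀.symm
    refine continuousAt_liftEdge true ?_ g ?_
    · rwa [rose_edge_zero]
    -- Below `1 / 2` one stays on the first half of the edge, where the transition between the
    -- charts is trivial.
    · have : Set.Iio (⟨1 / 2, by norm_num, by norm_num⟩ : I) ∈ 𝓝 (0 : I) :=
        isOpen_Iio.mem_nhds (show (0 : ℝ) < 1 / 2 by norm_num)
      filter_upwards [this] with s hs
      have hs' : (s : ℝ) < 1 / 2 := hs
      have hs₁ : s < 1 := Subtype.coe_lt_coe.1 (hs'.trans (by norm_num))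
      rw [if_pos hs₁]
      rcases s.2.1.eq_or_lt with h | h
      · obtain rfl : s = 0 := Subtype.ext h.symm
        rw [rose_edge_zero, roseCover_indexAt_pt]
        simp
      · rw [roseCover_indexAt_edge i h hs₁]
        have : side ((rose n).edge i s) = 1 := by
          refine side_of_neg (i := i) ?_
          rw [wave_edge, if_pos rfl]
          exact mul_neg_of_pos_of_neg (mul_pos h (by linarith)) (by linarith)
        simp [cochain, this]
  · rcases t.2.2.eq_or_lt with h₁ | h₁
    · obtain rfl : t = 1 := Subtype.ext h₁
      refine continuousAt_liftEdge true ?_ (g * FreeGroup.of i) ?_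
      · rwa [rose_edge_one]
      -- Above `1 / 2` the transition is `x_i`, so that the constant `g * x_i` in the vertex chart
      -- becomes `g` in the edge chart.
      · have : Set.Ioi (⟨1 / 2, by norm_num, by norm_num⟩ : I) ∈ 𝓝 (1 : I) :=
          isOpen_Ioi.mem_nhds (show (1 / 2 : ℝ) < 1 by norm_num)
        filter_upwards [this] with s hs
        have hs' : (1 / 2 : ℝ) < s := hs
        have hs₀ : 0 < s := Subtype.coe_lt_coe.1 ((by norm_num : (0 : ℝ) < 1 / 2).trans hs')
        rcases s.2.2.eq_or_lt with h | h
        · obtain rfl : s = 1 := Subtype.ext h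
          rw [rose_edge_one, roseCover_indexAt_pt]
          simp
        · rw [if_pos (show s < 1 from h), roseCover_indexAt_edge i hs₀ h]
          have : side ((rose n).edge i s) = FreeGroup.of i := by
            refine side_of_pos (i := i) ?_
            rw [wave_edge, if_pos rfl]
            exact mul_pos (mul_pos hs₀ (by linarith)) (by linarith)
          simp [cochain, this]
    · refine continuousAt_liftEdge false ⟨i, (hump_edge_pos i h₀ h₁).ne'⟩ g ?_
      filter_upwards [isOpen_Ioo.mem_nhds (⟨h₀, h₁⟩ : t ∈ Set.Ioo (0 : I) 1)] with s hs
      rw [if_pos hs.2, roseCover_indexAt_edge i hs.1 hs.2]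
      simp

/-- The lift of a loop of the rose. -/
def liftLoop (i : Fin n) (g : FreeGroup (Fin n)) : Path (sheet g) (sheet (g * FreeGroup.of i)) where
  toFun := liftEdge i g
  continuous_toFun := continuous_liftEdge i g
  source' := by
    exact mk_congr (rose_edge_zero i) (if_pos zero_lt_one)
  target' := by
    exact mk_congr (rose_edge_one i) (if_neg (lt_irrefl _))

/-- A letter acts on the sheets by right multiplication. For an inverse letter, the lift of the edge
which ends in the sheet `g` is run backwards. -/
theorem exists_lift_signedLoop (a : Fin n × Bool) (g : FreeGroup (Fin n)) :
    ∃ Γ : Path (sheet g) (sheet (g * FreeGroup.mk [a])),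
      ∀ t, (Γ t).proj = signedLoop (roseLoop a.1) a.2 t := by
  obtain ⟨i, b⟩ := a
  cases b
  · have h : g * FreeGroup.mk [(i, false)] * FreeGroup.of i = g := by
      have : FreeGroup.mk [(i, false)] = (FreeGroup.of i)⁻¹ := by
        simp [FreeGroup.of, FreeGroup.inv_mk, FreeGroup.invRev]
      rw [this, inv_mul_cancel_right]
    exact ⟨((liftLoop i (g * FreeGroup.mk [(i, false)])).cast rfl (by rw [h])).symm, fun t => rfl⟩
  · exact ⟨liftLoop i g, fun t => rfl⟩

theorem exists_lift_wordLoop (w : List (Fin n × Bool)) (g : FreeGroup (Fin n)) :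
    ∃ Γ : Path (sheet g) (sheet (g * FreeGroup.mk w)), ∀ t, (Γ t).proj = wordLoop w t := by
  induction w generalizing g with
  | nil =>
    refine ⟨(Path.refl (sheet g)).cast rfl ?_, fun t => rfl⟩
    rw [← FreeGroup.one_eq_mk, mul_one]
  | cons a w ih =>
    obtain ⟨Γ, hΓ⟩ := exists_lift_signedLoop a g
    obtain ⟨Δ, hΔ⟩ := ih (g * FreeGroup.mk [a])
    have h : g * FreeGroup.mk (a :: w) = g * FreeGroup.mk [a] * FreeGroup.mk w := by
      rw [mul_assoc, FreeGroup.mul_mk]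
      rfl
    refine ⟨(Γ.trans Δ).cast rfl (by rw [h]), fun t => ?_⟩
    simp only [Path.cast_coe, wordLoop, Path.trans_apply]
    split_ifs
    · exact hΓ _
    · exact hΔ _

/-- Words whose loops are homotopic represent the same element of the free group. -/
theorem mk_eq_of_homotopic {w w' : List (Fin n × Bool)}
    (h : (wordLoop w).Homotopic (wordLoop w')) : FreeGroup.mk w = FreeGroup.mk w' := by
  obtain ⟨Γ, hΓ⟩ := exists_lift_wordLoop w 1
  obtain ⟨Δ, hΔ⟩ := exists_lift_wordLoop w' 1
  have cov := roseCover_isCoveringMap n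
  -- Homotopic paths lifted from the same point end at the same point, and the end sheets are the
  -- group elements spelled by the words.
  have key := cov.liftPath_apply_one_eq_of_homotopicRel (γ₀ := (wordLoop w).toContinuousMap)
    (γ₁ := (wordLoop w').toContinuousMap) h (sheet 1) (wordLoop w).source (wordLoop w').source
  have hΓ' := (cov.eq_liftPath_iff' (Γ := Γ.toContinuousMap) (wordLoop w).source).2
    ⟨funext hΓ, Γ.source⟩
  have hΔ' := (cov.eq_liftPath_iff' (Γ := Δ.toContinuousMap) (wordLoop w').source).2
    ⟨funext hΔ, Δ.source⟩
  have h₁ : sheet (1 * FreeGroup.mk w) = sheet (1 * FreeGroup.mk w') := by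
    rw [← Γ.target, ← Δ.target]
    exact (DFunLike.congr_fun hΓ' 1).trans (key.trans (DFunLike.congr_fun hΔ' 1).symm)
  have := sheet_injective h₁
  simpa using this

end Covering

/-- An endomorphism whose self-map of the rose is homotopic to the identity is the identity. -/
theorem eq_id_of_roseSelfMap {n : ℕ} {f : FreeGroup (Fin n) →* FreeGroup (Fin n)}
    (h : PtHomotopic (rose n).pt (roseSelfMap f) (ContinuousMap.id _)) : f = MonoidHom.id _ := by
  ext1 i
  have h' := h.trans (roseSelfMap_id n).symm
  -- The restriction of the pointed homotopy to the edge `i` fixes both end points, since both are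
  -- the basepoint.
  have key : (wordLoop (f (FreeGroup.of i)).toWord).Homotopic
      (wordLoop (FreeGroup.of i).toWord) := by
    obtain ⟨F⟩ := h'
    refine ⟨⟨F.toHomotopy.comp (ContinuousMap.Homotopy.refl (roseLoop i).toContinuousMap), ?_⟩⟩
    rintro t x (rfl | rfl)
    · exact F.prop t _ (rose_edge_zero i)
    · exact F.prop t _ (rose_edge_one i)
  have := mk_eq_of_homotopic key
  rwa [FreeGroup.mk_toWord, FreeGroup.mk_toWord] at this

section Chains

open scoped Fin.NatCast Fin.CommRing

/-! ### Chains modulo two -/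

namespace FinGraph

variable (G : FinGraph)

instance : Fintype G.E := @Fintype.ofFinite _ G.finE

open Classical in
instance : DecidableEq G.E := inferInstance

/-- The boundary of the chain `w` is `u + v`, tested against all cochains. -/
def ChainJoins (w : G.E → ZMod 2) (u v : G.V) : Prop :=
  ∀ A : G.V → ZMod 2, ∑ e, w e * (A (G.d₀ e) + A (G.d₁ e)) = A u + A v

/-- The boundary of the chain `z` vanishes. -/
def IsClosedChain (z : G.E → ZMod 2) : Prop :=
  ∀ A : G.V → ZMod 2, ∑ e, z e * (A (G.d₀ e) + A (G.d₁ e)) = 0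

/-- Two vertices are joined by edges of the set `S`. -/
def JoinedIn (S : Set G.E) : G.V → G.V → Prop :=
  Relation.EqvGen fun a b => ∃ e ∈ S, G.d₀ e = a ∧ G.d₁ e = b

variable {G}

theorem ChainJoins.isClosedChain {w : G.E → ZMod 2} {u : G.V} (h : G.ChainJoins w u u) :
    G.IsClosedChain w := fun A => (h A).trans (CharTwo.add_self_eq_zero _)

theorem ChainJoins.refl (u : G.V) : G.ChainJoins 0 u u := fun A => by
  simp [CharTwo.add_self_eq_zero]

theorem ChainJoins.symm {w : G.E → ZMod 2} {u v : G.V} (h : G.ChainJoins w u v) :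
    G.ChainJoins w v u := fun A => (h A).trans (add_comm _ _)

theorem ChainJoins.trans {w w' : G.E → ZMod 2} {u v x : G.V} (h : G.ChainJoins w u v)
    (h' : G.ChainJoins w' v x) : G.ChainJoins (w + w') u x := fun A => by
  simp only [Pi.add_apply, add_mul, Finset.sum_add_distrib]
  rw [h A, h' A, add_assoc, ← add_assoc (A v), CharTwo.add_self_eq_zero, zero_add]

theorem ChainJoins.add_closed {w z : G.E → ZMod 2} {u v : G.V} (h : G.ChainJoins w u v)
    (hz : G.IsClosedChain z) : G.ChainJoins (w + z) u v := fun A => by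
  simp only [Pi.add_apply, add_mul, Finset.sum_add_distrib]
  rw [h A, hz A, add_zero]

theorem IsClosedChain.sum {ι : Type*} (s : Finset ι) {z : ι → G.E → ZMod 2}
    (h : ∀ i ∈ s, G.IsClosedChain (z i)) : G.IsClosedChain (∑ i ∈ s, z i) := fun A => by
  simp only [Finset.sum_apply, Finset.sum_mul]
  rw [Finset.sum_comm]
  exact Finset.sum_eq_zero fun i hi => h i hi A

theorem IsClosedChain.smul {z : G.E → ZMod 2} (h : G.IsClosedChain z) (a : ZMod 2) :
    G.IsClosedChain (a • z) := fun A => by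
  simp only [Pi.smul_apply, smul_eq_mul, mul_assoc]
  rw [← Finset.mul_sum, h A, mul_zero]

theorem chainJoins_single (a : G.E × Bool) :
    G.ChainJoins (Pi.single a.1 1) (G.start a) (G.finish a) := fun A => by
  rw [Finset.sum_eq_single a.1 (fun e _ he => by simp [he]) (by simp)]
  obtain ⟨e, b⟩ := a
  cases b <;> simp [start, finish, add_comm]

theorem JoinedIn.exists_chainJoins {S : Set G.E} {u v : G.V} (h : G.JoinedIn S u v) :
    ∃ w, G.ChainJoins w u v ∧ ∀ e ∉ S, w e = 0 := by
  induction h with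
  | rel u v h =>
    obtain ⟨e, he, rfl, rfl⟩ := h
    refine ⟨_, chainJoins_single (e, true), fun a ha => ?_⟩
    exact Pi.single_eq_of_ne (fun h => ha (by rw [h]; exact he)) _
  | refl u => exact ⟨0, .refl u, fun _ _ => rfl⟩
  | symm u v _ ih =>
    obtain ⟨w, hw, hS⟩ := ih
    exact ⟨w, hw.symm, hS⟩
  | trans u v x _ _ ih ih' =>
    obtain ⟨w, hw, hS⟩ := ih
    obtain ⟨w', hw', hS'⟩ := ih'
    exact ⟨w + w', hw.trans hw', fun e he => by simp [hS e he, hS' e he]⟩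

/-! #### Arcs of cycles -/

/-- The sum of `r` consecutive edges of the cycle `p`, from the position `i` on. -/
def arc {m : ℕ} (p : Fin (m + 1) → G.E × Bool) (i : Fin (m + 1)) (r : ℕ) : G.E → ZMod 2 :=
  ∑ l ∈ Finset.range r, Pi.single (p (i + (l : Fin (m + 1)))).1 1

theorem IsCycle.chainJoins_arc {m : ℕ} {p : Fin (m + 1) → G.E × Bool} (hp : G.IsCycle p)
    (i : Fin (m + 1)) (r : ℕ) :
    G.ChainJoins (arc p i r) (G.start (p i)) (G.start (p (i + (r : Fin (m + 1))))) := by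
  induction r with
  | zero => simpa [arc] using ChainJoins.refl (G.start (p i))
  | succ r ih =>
    have h : arc p i (r + 1) = arc p i r + Pi.single (p (i + (r : Fin (m + 1)))).1 1 :=
      Finset.sum_range_succ _ _
    rw [h]
    have := chainJoins_single (p (i + (r : Fin (m + 1))))
    rw [hp.closed] at this
    push_cast
    rw [← add_assoc]
    exact ih.trans this

/-- Within one full turn no edge repeats, so exactly the first `r` edges from position `i` have
coefficient one. In particular the arc omits the edge at which it stops, unless it is a full turn.
-/
theorem IsCycle.arc_apply {m : ℕ} {p : Fin (m + 1) → G.E × Bool} (hp : G.IsCycle p)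
    (i : Fin (m + 1)) {l r : ℕ} (hl : l < m + 1) (hr : r ≤ m + 1) :
    arc p i r (p (i + (l : Fin (m + 1)))).1 = if l < r then 1 else 0 := by
  have key : ∀ l' < m + 1,
      (p (i + (l : Fin (m + 1)))).1 = (p (i + (l' : Fin (m + 1)))).1 → l = l' := by
    intro l' hl' h
    have := congrArg Fin.val (add_left_cancel (hp.edge_injective h))
    rwa [Fin.val_natCast, Fin.val_natCast, Nat.mod_eq_of_lt hl, Nat.mod_eq_of_lt hl'] at this
  rw [arc, Finset.sum_apply]
  split_ifs with h
  · rw [Finset.sum_eq_single l, Pi.single_eq_same]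
    · intro l' hl' hne
      exact Pi.single_eq_of_ne
        (fun h => hne (key l' ((Finset.mem_range.1 hl').trans_le hr) h).symm) _
    · exact fun h' => (h' (Finset.mem_range.2 h)).elim
  · refine Finset.sum_eq_zero fun l' hl' => Pi.single_eq_of_ne (fun h' => h ?_) _
    rw [Finset.mem_range] at hl'
    rwa [key l' (hl'.trans_le hr) h']

theorem arc_apply_of_forall_ne {m : ℕ} {p : Fin (m + 1) → G.E × Bool} (i : Fin (m + 1)) (r : ℕ)
    {e : G.E} (h : ∀ j, (p j).1 ≠ e) : arc p i r e = 0 := by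
  rw [arc, Finset.sum_apply]
  exact Finset.sum_eq_zero fun l _ => Pi.single_eq_of_ne (h _).symm _

/-- The closed chain of a cycle. -/
def cycleChain {m : ℕ} (p : Fin (m + 1) → G.E × Bool) : G.E → ZMod 2 := arc p 0 (m + 1)

theorem IsCycle.isClosedChain {m : ℕ} {p : Fin (m + 1) → G.E × Bool} (hp : G.IsCycle p) :
    G.IsClosedChain (cycleChain p) := by
  have := hp.chainJoins_arc 0 (m + 1)
  rw [zero_add, Fin.natCast_self] at this
  exact this.isClosedChain

theorem IsCycle.cycleChain_apply {m : ℕ} {p : Fin (m + 1) → G.E × Bool} (hp : G.IsCycle p)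
    (j : Fin (m + 1)) : cycleChain p (p j).1 = 1 := by
  have := hp.arc_apply 0 j.2 le_rfl
  rwa [if_pos j.2, zero_add, Fin.cast_val_eq_self] at this

theorem cycleChain_apply_of_forall_ne {m : ℕ} {p : Fin (m + 1) → G.E × Bool} {e : G.E}
    (h : ∀ j, (p j).1 ≠ e) : cycleChain p e = 0 := arc_apply_of_forall_ne _ _ h

/-! #### Cycles in the support of a closed chain -/

theorem start_eq_finish {x y : G.E × Bool} (h : x.1 = y.1) (hb : x.2 ≠ y.2) :
    G.start x = G.finish y := by
  obtain ⟨a, b⟩ := x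
  obtain ⟨a', b'⟩ := y
  obtain rfl : a = a' := h
  cases b <;> cases b' <;> first | rfl | exact (hb rfl).elim

/-- An edge whose ends are joined by edges of `S` lies on a cycle in `S` with this edge added. -/
theorem JoinedIn.exists_isCycle {S : Set G.E} {e : G.E} (he : e ∉ S)
    (h : G.JoinedIn S (G.d₁ e) (G.d₀ e)) :
    ∃ (m : ℕ) (p : Fin (m + 1) → G.E × Bool), G.IsCycle p ∧ ∀ j, (p j).1 = e ∨ (p j).1 ∈ S := by
  let H : SimpleGraph G.V := SimpleGraph.fromRel fun a b => ∃ e ∈ S, G.d₀ e = a ∧ G.d₁ e = b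
  have hH : ∀ u v, G.JoinedIn S u v → H.Reachable u v := by
    intro u v h
    induction h with
    | rel u v h =>
      by_cases huv : u = v
      · rw [huv]
      · exact SimpleGraph.Adj.reachable ((SimpleGraph.fromRel_adj _ _ _).2 ⟨huv, .inl h⟩)
    | refl u => exact .refl u
    | symm u v _ ih => exact ih.symm
    | trans u v x _ _ ih ih' => exact ih.trans ih'
  obtain ⟨w, hw⟩ := (hH _ _ h).exists_isPath
  have step : ∀ j, j < w.length → ∃ a : G.E × Bool, a.1 ∈ S ∧ G.start a = w.getVert j ∧
      G.finish a = w.getVert (j + 1) := by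
    intro j hj
    obtain ⟨-, ⟨a, ha, h₀, h₁⟩ | ⟨a, ha, h₀, h₁⟩⟩ :=
      (SimpleGraph.fromRel_adj _ _ _).1 (w.adj_getVert_succ hj)
    · exact ⟨(a, true), ha, h₀, h₁⟩
    · exact ⟨(a, false), ha, h₁, h₀⟩
  choose q hqS hq₀ hq₁ using step
  have inj : ∀ {i j}, i ≤ w.length → j ≤ w.length → w.getVert i = w.getVert j → i = j :=
    fun hi hj hij => hw.getVert_injOn hi hj hij
  -- The path `w` runs from the end of `e` to its start, and `e` in the last position closes it up.
  -- If `e` is a loop, `w` has length zero and the cycle is `e` alone.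
  let p : Fin (w.length + 1) → G.E × Bool := fun j =>
    if h : j.1 < w.length then q j.1 h else (e, true)
  have p_lt : ∀ (j : Fin (w.length + 1)) (h : j.1 < w.length), p j = q j.1 h :=
    fun j h => dif_pos h
  have p_last : ∀ j : Fin (w.length + 1), ¬ j.1 < w.length → p j = (e, true) :=
    fun j h => dif_neg h
  have p_start : ∀ j, G.start (p j) = w.getVert j.1 := by
    intro j
    by_cases h : j.1 < w.length
    · rw [p_lt j h, hq₀]
    · rw [p_last j h, show j.1 = w.length by omega, w.getVert_length]
      rfl
  refine ⟨w.length, p, ⟨fun j => ?_, fun i j hij => ?_, fun i j hij => ?_⟩, fun j => ?_⟩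
  · rw [p_start]
    by_cases h : j.1 < w.length
    · rw [p_lt j h, hq₁, Fin.val_add_one_of_lt (Fin.lt_def.2 (by simpa using h))]
    · have hj : j = Fin.last _ := Fin.ext (by rw [Fin.val_last]; omega)
      rw [p_last j h, hj, Fin.last_add_one, Fin.val_zero, w.getVert_zero]
      rfl
  · simp only [p_start] at hij
    exact Fin.ext (inj (Nat.lt_succ_iff.1 i.2) (Nat.lt_succ_iff.1 j.2) hij)
  · dsimp only at hij
    by_cases hi : i.1 < w.length <;> by_cases hj : j.1 < w.length
    · rw [p_lt i hi, p_lt j hj] at hij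
      by_cases hb : (q i.1 hi).2 = (q j.1 hj).2
      · have h := hq₀ i.1 hi
        rw [Prod.ext hij hb, hq₀] at h
        exact Fin.ext (inj hj.le hi.le h).symm
      -- An edge used twice in opposite directions would give both `i = j + 1` and `j = i + 1`.
      · have h₀ := start_eq_finish hij hb
        have h₁ := (start_eq_finish hij.symm (Ne.symm hb)).symm
        rw [hq₀, hq₁] at h₀ h₁
        have := inj hi.le hj h₀
        have := inj hi hj.le h₁
        omega
    · rw [p_lt i hi, p_last j hj] at hij
      exact (he (Eq.subst (motive := (· ∈ S)) hij (hqS i.1 hi))).elim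
    · rw [p_last i hi, p_lt j hj] at hij
      exact (he (Eq.subst (motive := (· ∈ S)) hij.symm (hqS j.1 hj))).elim
    · exact Fin.ext (by omega)
  · by_cases h : j.1 < w.length
    · rw [p_lt j h]
      exact .inr (hqS _ _)
    · rw [p_last j h]
      exact .inl rfl

/-- Test the chain against the indicator of the set of vertices reachable from the end of `e` in the
support without `e`. All other edges contribute zero; if the start of `e` were not reachable, `e`
alone would contribute `z e`. -/
theorem IsClosedChain.joinedIn {z : G.E → ZMod 2} (hz : G.IsClosedChain z) {e : G.E}
    (he : z e ≠ 0) : G.JoinedIn {a | z a ≠ 0 ∧ a ≠ e} (G.d₁ e) (G.d₀ e) := by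
  classical
  by_contra h
  have key := hz fun v => if G.JoinedIn {a | z a ≠ 0 ∧ a ≠ e} (G.d₁ e) v then 1 else 0
  rw [Finset.sum_eq_single e, if_neg h, if_pos (.refl _), zero_add, mul_one] at key
  · exact he key
  · intro a _ ha
    by_cases hza : z a = 0
    · rw [hza, zero_mul]
    · have hr : G.JoinedIn {a | z a ≠ 0 ∧ a ≠ e} (G.d₀ a) (G.d₁ a) :=
        .rel _ _ ⟨a, ⟨hza, ha⟩, rfl, rfl⟩
      have : G.JoinedIn {a | z a ≠ 0 ∧ a ≠ e} (G.d₁ e) (G.d₀ a) ↔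
          G.JoinedIn {a | z a ≠ 0 ∧ a ≠ e} (G.d₁ e) (G.d₁ a) :=
        ⟨fun h => h.trans _ _ _ hr, fun h => h.trans _ _ _ (hr.symm _ _)⟩
      rw [if_congr this rfl rfl, CharTwo.add_self_eq_zero, mul_zero]
  · simp

end FinGraph

/-! ### Closed chains and basic cycles of a partitioned graph -/

namespace PartitionedGraph

variable {n : ℕ} {G : PartitionedGraph n}

/-- An edge of the support lies on a cycle inside the support, and this cycle contains an edge set.
All later contradictions come from here: a nonzero closed chain cannot miss an edge of every color.
-/
theorem exists_forall_ne_zero {z : G.E → ZMod 2} (hz : G.IsClosedChain z) (h : z ≠ 0) :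
    ∃ i, ∀ e, G.color e = i → z e ≠ 0 := by
  obtain ⟨e, he⟩ := Function.ne_iff.1 h
  obtain ⟨m, p, hp, hpS⟩ := (hz.joinedIn he).exists_isCycle (by simp)
  obtain ⟨i, hi⟩ := G.cycle_contains m p hp
  refine ⟨i, fun a ha => ?_⟩
  obtain ⟨j, rfl⟩ := hi a ha
  rcases hpS j with h | h
  · rwa [h]
  · exact h.1

/-- A family of closed chains like those of the basic cycles of an edge basis `b`. -/
structure IsBasicFamily (b : Fin n → G.E) (c : Fin n → G.E → ZMod 2) : Prop where
  basis : G.IsEdgeBasis b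
  closed : ∀ k, G.IsClosedChain (c k)
  apply_color : ∀ e, c (G.color e) e = 1
  apply_basis : ∀ i k, i ≠ k → c k (b i) = 0

/-- In every nonempty set of colors there is one whose edges lie on no other basic cycle with
color in this set. -/
theorem IsBasicFamily.exists_source {b : Fin n → G.E} {c : Fin n → G.E → ZMod 2}
    (h : G.IsBasicFamily b c) (U : Finset (Fin n)) (hU : U.Nonempty) :
    ∃ k ∈ U, ∀ i ∈ U, i ≠ k → ∀ e, G.color e = k → c i e = 0 := by
  induction U using Finset.strongInduction with
  | H U ih =>
    by_contra! hcon
    -- If `U` has no such color, take one, `s k`, for `U` without `k`. As it fails for `U`, an edge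
    -- `a k` of color `s k` lies on the basic cycle of `k`; among the cycles with colors in `U`,
    -- only those of `k` and `s k` contain it.
    have hs : ∀ k : U, ∃ s : U, s ≠ k ∧
        (∀ i ∈ U, i ≠ k.1 → i ≠ s.1 → ∀ e, G.color e = s.1 → c i e = 0) ∧
        ∃ e, G.color e = s.1 ∧ c k e ≠ 0 := by
      rintro ⟨k, hk⟩
      obtain ⟨i, hi, hik, -⟩ := hcon k hk
      obtain ⟨s, hs, hs'⟩ := ih (U.erase k) (Finset.erase_ssubset hk)
        ⟨i, Finset.mem_erase.2 ⟨hik, hi⟩⟩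
      rw [Finset.mem_erase] at hs
      have hs'' : ∀ i ∈ U, i ≠ k → i ≠ s → ∀ e, G.color e = s → c i e = 0 :=
        fun i hi hik his => hs' i (Finset.mem_erase.2 ⟨hik, hi⟩) his
      refine ⟨⟨s, hs.2⟩, fun h => hs.1 (congrArg Subtype.val h), hs'', ?_⟩
      obtain ⟨j, hj, hjs, e, he, hje⟩ := hcon s hs.2
      by_cases hjk : j = k
      · exact ⟨e, he, hjk ▸ hje⟩
      · exact (hje (hs'' j hj hjk hjs e he)).elim
    choose s hsk hs a ha hak using hs
    -- If `s k = s k'` with `k ≠ k'`, then `a k` would lie on the cycle of `k`, a third cycle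
    -- besides those of `k'` and `s k'`.
    have inj : Function.Injective s := by
      intro k k' hkk'
      by_contra hne
      refine hak k (hs k' k k.2 (fun h => hne (Subtype.ext h)) ?_ _ ?_)
      · rw [← hkk']
        exact fun h => hsk k (Subtype.ext h.symm)
      · rw [ha, hkk']
    have surj := Finite.injective_iff_surjective.1 inj
    -- The sum of the basic cycles with colors in `U` is nonzero but contains no edge set: it misses
    -- `b i` for `i` outside `U`, and for `i = s k` it misses `a k`, where two cycles cancel.
    have apply_b : ∀ k, (∑ i ∈ U, c i) (b k) = if k ∈ U then 1 else 0 := by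
      intro k
      rw [Finset.sum_apply]
      have hk : c k (b k) = 1 := by
        have := h.apply_color (b k)
        rwa [h.basis k] at this
      split_ifs with hkU
      · rw [Finset.sum_eq_single k (fun i _ hik => h.apply_basis k i hik.symm)
          (fun h => (h hkU).elim), hk]
      · exact Finset.sum_eq_zero fun i hi => h.apply_basis k i (by rintro rfl; exact hkU hi)
    obtain ⟨k₀, hk₀⟩ := hU
    obtain ⟨i, hi⟩ := exists_forall_ne_zero (FinGraph.IsClosedChain.sum U fun i _ => h.closed i) (z := ∑ i ∈ U, c i) (by
      intro h0
      have := apply_b k₀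
      rw [h0, if_pos hk₀] at this
      exact zero_ne_one this)
    by_cases hiU : i ∈ U
    · obtain ⟨k, hk⟩ := surj ⟨i, hiU⟩
      have hki : (s k).1 = i := congrArg Subtype.val hk
      refine hi (a k) ((ha k).trans hki) ?_
      have hne : (s k).1 ≠ k.1 := fun h => hsk k (Subtype.ext h)
      rw [Finset.sum_apply, ← Finset.sum_subset (s₁ := {(s k).1, k.1})]
      · have h₁ := h.apply_color (a k)
        rw [ha] at h₁
        rw [Finset.sum_pair hne, h₁, Fin.eq_one_of_ne_zero _ (hak k)]
        rfl
      · intro x hx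
        rcases Finset.mem_insert.1 hx with rfl | hx
        · exact (s k).2
        · rw [Finset.mem_singleton.1 hx]
          exact k.2
      · intro x hx hx'
        rw [Finset.mem_insert, Finset.mem_singleton, not_or] at hx'
        exact hs k x hx hx'.2 hx'.1 _ (ha k)
    · refine hi (b i) (h.basis i) ?_
      rw [apply_b, if_neg hiU]

/-- Edges of color `k` on an oriented basic cycle are told apart by their starting points, up to
the edges with colors in `U`. -/
theorem IsBasicFamily.eq_of_joinedIn {b : Fin n → G.E} {c : Fin n → G.E → ZMod 2}
    (h : G.IsBasicFamily b c) {U : Finset (Fin n)}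
    (hU : ∀ u ∈ U, ∀ e, G.color e ∉ U → c u e = 0) {k : Fin n} (hk : k ∉ U) {m : ℕ}
    {p : Fin (m + 1) → G.E × Bool} (hp : G.IsBasicCycle b k p) {i j : Fin (m + 1)}
    (hi : G.color (p i).1 = k) (hj : G.color (p j).1 = k)
    (hij : G.JoinedIn {e | G.color e ∈ U} (G.start (p i)) (G.start (p j))) : i = j := by
  by_contra hne
  obtain ⟨w, hw, hwU⟩ := hij.exists_chainJoins
  -- adjust `w` by basic cycles so that it avoids the edge basis
  let w' := w + ∑ u ∈ U, w (b u) • c u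
  have hw' : G.ChainJoins w' (G.start (p i)) (G.start (p j)) :=
    hw.add_closed (FinGraph.IsClosedChain.sum _ fun u _ => (h.closed u).smul _)
  have hw'U : ∀ e, G.color e ∉ U → w' e = 0 := by
    intro e he
    simp only [w', Pi.add_apply, Finset.sum_apply, Pi.smul_apply]
    rw [hwU e he, zero_add]
    exact Finset.sum_eq_zero fun u hu => by rw [hU u hu e he, smul_zero]
  have hw'b : ∀ u, w' (b u) = 0 := by
    intro u
    by_cases hu : u ∈ U
    · simp only [w', Pi.add_apply, Finset.sum_apply, Pi.smul_apply]
      have hu' : c u (b u) = 1 := by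
        have := h.apply_color (b u)
        rwa [h.basis u] at this
      rw [Finset.sum_eq_single u (fun i _ hiu => by rw [h.apply_basis u i hiu.symm, smul_zero])
        (fun h => (h hu).elim), hu', smul_eq_mul, mul_one, CharTwo.add_self_eq_zero]
    · exact hw'U _ (by rwa [h.basis u])
  -- The arc from position `i` to position `j` contains the edge `p i` but not `p j`. Closed up by
  -- `w'`, it is a nonzero closed chain missing `p j` of color `k`, and `b l` for every other color
  -- `l`.
  let r : ℕ := (j - i).1
  have hr : r < m + 1 := (j - i).2
  have hr₀ : 0 < r := Nat.pos_of_ne_zero fun h0 => hne (sub_eq_zero.1 (Fin.ext h0)).symm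
  have hrj : i + (r : Fin (m + 1)) = j := by
    rw [Fin.cast_val_eq_self, add_sub_cancel]
  have harc := hp.1.chainJoins_arc i r
  rw [hrj] at harc
  have hz := (harc.trans hw'.symm).isClosedChain
  have hzi : (FinGraph.arc p i r + w') (p i).1 = 1 := by
    have := hp.1.arc_apply i (Nat.succ_pos m) hr.le
    rw [if_pos hr₀, Nat.cast_zero, add_zero] at this
    rw [Pi.add_apply, this, hw'U _ (by rwa [hi]), add_zero]
  obtain ⟨l, hl⟩ := exists_forall_ne_zero hz (fun h0 => by
    rw [h0] at hzi
    exact zero_ne_one hzi)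
  by_cases hlk : l = k
  · refine hl (p j).1 (hj.trans hlk.symm) ?_
    have := hp.1.arc_apply i hr hr.le
    rw [if_neg (lt_irrefl _), hrj] at this
    rw [Pi.add_apply, this, hw'U _ (by rwa [hj]), add_zero]
  · refine hl (b l) (h.basis l) ?_
    rw [Pi.add_apply, hw'b, add_zero]
    exact FinGraph.arc_apply_of_forall_ne _ _ fun j => hp.2 j l hlk

/-! ### Color automorphisms fix all cells -/

/-- An automorphism of a graph with a fixed vertex which preserves colors and orientations. -/
structure IsColorAut (v₀ : G.V) (ψ : G.V → G.V) (φ : G.E → G.E) : Prop where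
  map_base : ψ v₀ = v₀
  map_d₀ : ∀ e, ψ (G.d₀ e) = G.d₀ (φ e)
  map_d₁ : ∀ e, ψ (G.d₁ e) = G.d₁ (φ e)
  map_color : ∀ e, G.color (φ e) = G.color e

theorem IsColorAut.joinedIn {v₀ : G.V} {ψ : G.V → G.V} {φ : G.E → G.E}
    (h : G.IsColorAut v₀ ψ φ) {U : Finset (Fin n)} {u v : G.V}
    (huv : G.JoinedIn {e | G.color e ∈ U} u v) :
    G.JoinedIn {e | G.color e ∈ U} (ψ u) (ψ v) := by
  induction huv with
  | rel u v huv =>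
    obtain ⟨e, he, rfl, rfl⟩ := huv
    refine .rel _ _ ⟨φ e, ?_, (h.map_d₀ e).symm, (h.map_d₁ e).symm⟩
    rw [Set.mem_ofPred_eq, h.map_color]
    exact he
  | refl u => exact .refl _
  | symm u v _ ih => exact ih.symm
  | trans u v x _ _ ih ih' => exact ih.trans _ _ _ ih'

/-- If a color preserving automorphism fixes the edges with colors outside `U` and different from
`k`, then it fixes the edges of color `k`. -/
theorem IsBasicFamily.fixes_color {b : Fin n → G.E} {c : Fin n → G.E → ZMod 2}
    (h : G.IsBasicFamily b c) {U : Finset (Fin n)}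
    (hU : ∀ u ∈ U, ∀ e, G.color e ∉ U → c u e = 0) {k : Fin n} (hk : k ∉ U) {m : ℕ}
    {p : Fin (m + 1) → G.E × Bool} (hp : G.IsBasicCycle b k p)
    (hpk : ∀ e, G.color e = k → ∃ j, p j = (e, true))
    (hpU : ∀ j, G.color (p j).1 = k ∨ G.color (p j).1 ∈ U)
    {v₀ : G.V} {ψ : G.V → G.V} {φ : G.E → G.E} (hφ : G.IsColorAut v₀ ψ φ)
    (hfix : ∀ e, G.color e ≠ k → G.color e ∉ U → φ e = e) (e : G.E) (he : G.color e = k) :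
    φ e = e := by
  let R := G.JoinedIn {e | G.color e ∈ U}
  -- The image of a `k`-colored edge is again a positively directed edge of the cycle. If its start
  -- is joined to the old one by edges of `U`, the two edges agree by `eq_of_joinedIn`.
  have rot : ∀ j, G.color (p j).1 = k → R (ψ (G.start (p j))) (G.start (p j)) →
      φ (p j).1 = (p j).1 ∧ (p j).2 = true := by
    intro j hj hR
    obtain ⟨i, hi⟩ := hpk _ hj
    have hij : i = j := hp.1.edge_injective (congrArg Prod.fst hi :)
    rw [hij] at hi
    obtain ⟨i', hi'⟩ := hpk (φ (p j).1) (by rw [hφ.map_color, hj])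
    have h₂ : (p j).2 = true := (congrArg Prod.snd hi)
    have hs : G.start (p j) = G.d₀ (p j).1 := by rw [FinGraph.start, if_pos h₂]
    have hs' : G.start (p i') = ψ (G.start (p j)) := by
      rw [hi', hs, hφ.map_d₀]
      rfl
    have : i' = j := h.eq_of_joinedIn hU hk hp (by rw [hi', hφ.map_color, hj]) hj (by
      rw [hs']
      exact hR)
    rw [this] at hi'
    exact ⟨(congrArg Prod.fst hi').symm, h₂⟩
  have step : ∀ j, R (ψ (G.start (p j))) (G.start (p j)) →
      R (ψ (G.start (p (j + 1)))) (G.start (p (j + 1))) := by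
    intro j hR
    rw [← hp.1.closed j]
    rcases hpU j with hj | hj
    · obtain ⟨h₁, h₂⟩ := rot j hj hR
      rw [FinGraph.finish, if_pos h₂, hφ.map_d₁, h₁]
      exact .refl _
    · have hR' : R (G.start (p j)) (G.finish (p j)) := by
        rcases hb : p j with ⟨a, _ | _⟩
        · exact .symm _ _ (.rel _ _ ⟨a, by simpa [hb] using hj, rfl, rfl⟩)
        · exact .rel _ _ ⟨a, by simpa [hb] using hj, rfl, rfl⟩
      exact (hφ.joinedIn hR').symm.trans _ _ _ (hR.trans _ _ _ hR')
  -- One position of the cycle that is fixed modulo `U` suffices, since `step` carries this property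
  -- around the cycle.
  obtain ⟨j₀, hj₀⟩ : ∃ j, R (ψ (G.start (p j))) (G.start (p j)) := by
    by_contra! hcon
    -- the vertices joined to the cycle are closed under adjacency
    have hW : ∀ u v, Relation.EqvGen (fun a b => ∃ e, G.d₀ e = a ∧ G.d₁ e = b) u v →
        ((∃ j, R u (G.start (p j))) ↔ ∃ j, R v (G.start (p j))) := by
      intro u v huv
      induction huv with
      | rel u v huv =>
        obtain ⟨a, rfl, rfl⟩ := huv
        by_cases hak : G.color a = k
        · obtain ⟨j, hj⟩ := hpk a hak
          refine iff_of_true ⟨j, ?_⟩ ⟨j + 1, ?_⟩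
          · rw [hj]
            exact .refl _
          · rw [← hp.1.closed, hj]
            exact .refl _
        · by_cases haU : G.color a ∈ U
          · have hR : R (G.d₀ a) (G.d₁ a) := .rel _ _ ⟨a, haU, rfl, rfl⟩
            exact ⟨fun ⟨j, hj⟩ => ⟨j, (hR.symm).trans _ _ _ hj⟩,
              fun ⟨j, hj⟩ => ⟨j, hR.trans _ _ _ hj⟩⟩
          -- A fixed vertex joined to the cycle by edges of `U` would yield the missing position. So
          -- fixed edges do not touch the set of vertices joined to the cycle, which by
          -- connectedness then contains the fixed vertex `v₀`, a contradiction.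
          · have hno : ∀ v, ψ v = v → ¬ ∃ j, R v (G.start (p j)) := by
              rintro v hv ⟨j, hj⟩
              have := hφ.joinedIn hj
              rw [hv] at this
              exact hcon j ((this.symm).trans _ _ _ hj)
            refine iff_of_false (hno _ ?_) (hno _ ?_)
            · rw [hφ.map_d₀, hfix a hak haU]
            · rw [hφ.map_d₁, hfix a hak haU]
      | refl u => rfl
      | symm u v _ ih => exact ih.symm
      | trans u v x _ _ ih ih' => exact ih.trans ih'
    obtain ⟨j, hj⟩ := (hW _ _ (G.connected (G.start (p 0)) v₀)).1 ⟨0, .refl _⟩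
    have := hφ.joinedIn hj
    rw [hφ.map_base] at this
    exact hcon j ((this.symm).trans _ _ _ hj)
  have all : ∀ l : ℕ, R (ψ (G.start (p (j₀ + (l : Fin (m + 1))))))
      (G.start (p (j₀ + (l : Fin (m + 1))))) := by
    intro l
    induction l with
    | zero => simpa using hj₀
    | succ l ih =>
      push_cast
      rw [← add_assoc]
      exact step _ ih
  obtain ⟨j, hj⟩ := hpk e he
  have hR := all (j - j₀).1
  rw [Fin.cast_val_eq_self, add_sub_cancel] at hR
  have := (rot j (by rw [hj]; exact he) hR).1
  rwa [hj] at this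

/-- Automorphisms which fix a vertex and preserve colors and orientations fix all edges. -/
theorem IsColorAut.edge_eq (hG : G.IsOriented) {v₀ : G.V} {ψ : G.V → G.V} {φ : G.E → G.E}
    (hφ : G.IsColorAut v₀ ψ φ) (e : G.E) : φ e = e := by
  obtain ⟨b, hb, hG⟩ := hG
  choose m p hp hpk using hG
  have hfam : G.IsBasicFamily b fun k => FinGraph.cycleChain (p k) := by
    refine ⟨hb, fun k => (hp k).1.isClosedChain, fun e => ?_, fun i k hik => ?_⟩
    · obtain ⟨j, hj⟩ := hpk _ e rfl
      have := (hp (G.color e)).1.cycleChain_apply j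
      rwa [hj] at this
    · exact FinGraph.cycleChain_apply_of_forall_ne fun j => (hp k).2 j i hik
  -- Invariants of the descent on the set `U` of colors still to be treated: basic cycles with
  -- colors in `U` use only colors in `U`, and all edges of other colors are fixed. Removing a color
  -- supplied by `exists_source` preserves both.
  have key : ∀ U : Finset (Fin n),
      (∀ u ∈ U, ∀ e, G.color e ∉ U → FinGraph.cycleChain (p u) e = 0) →
      (∀ e, G.color e ∉ U → φ e = e) → ∀ e, φ e = e := by
    intro U
    induction U using Finset.strongInduction with
    | H U ih =>
      intro hU hfix
      rcases U.eq_empty_or_nonempty with rfl | hne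
      · exact fun e => hfix e (Finset.notMem_empty _)
      obtain ⟨k, hk, hsrc⟩ := hfam.exists_source U hne
      have hU' : ∀ u ∈ U.erase k, ∀ e, G.color e ∉ U.erase k →
          FinGraph.cycleChain (p u) e = 0 := by
        intro u hu e he
        rw [Finset.mem_erase] at hu he
        by_cases hek : G.color e = k
        · exact hsrc u hu.2 hu.1 e hek
        · exact hU u hu.2 e fun h => he ⟨hek, h⟩
      refine ih (U.erase k) (Finset.erase_ssubset hk) hU' fun e he => ?_
      by_cases hek : G.color e = k
      · refine hfam.fixes_color hU' (Finset.notMem_erase k U) (hp k) (hpk k) (fun j => ?_) hφ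
          (fun a hak ha => hfix a fun h => ha (Finset.mem_erase.2 ⟨hak, h⟩)) e hek
        by_cases hj : G.color (p k j).1 = k
        · exact .inl hj
        · refine .inr (Finset.mem_erase.2 ⟨hj, ?_⟩)
          by_contra hjU
          have := hU k hk _ hjU
          rw [(hp k).1.cycleChain_apply j] at this
          exact one_ne_zero this
      · exact hfix e fun h => he (Finset.mem_erase.2 ⟨hek, h⟩)
  exact key Finset.univ (fun _ _ e he => (he (Finset.mem_univ _)).elim)
    (fun e he => (he (Finset.mem_univ _)).elim) e

theorem IsColorAut.vertex_eq (hG : G.IsOriented) {v₀ : G.V} {ψ : G.V → G.V} {φ : G.E → G.E}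
    (hφ : G.IsColorAut v₀ ψ φ) (v : G.V) : ψ v = v := by
  have h : ∀ u v, Relation.EqvGen (fun a b => ∃ e, G.d₀ e = a ∧ G.d₁ e = b) u v →
      (ψ u = u ↔ ψ v = v) := by
    intro u v huv
    induction huv with
    | rel u v huv =>
      obtain ⟨e, rfl, rfl⟩ := huv
      rw [hφ.map_d₀, hφ.map_d₁, hφ.edge_eq hG]
      exact iff_of_true rfl rfl
    | refl u => rfl
    | symm u v _ ih => exact ih.symm
    | trans u v x _ _ ih ih' => exact ih.trans ih'
  exact (h _ _ (G.connected v₀ v)).1 hφ.map_base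

end PartitionedGraph

end Chains

/-! ### Self-equivalences of colored graphs -/

/-- The property of being the vertex `v` is defined cell by cell and respects the gluing, so it
descends to the quotient and separates `v` from the other vertices. -/
theorem FinGraph.vertex_injective (G : FinGraph) : Function.Injective G.vertex := by
  intro v w h
  let F : G.Space → Prop := Quot.lift (Sum.elim (fun a => a.1 = v)
    (fun a => a.2 = 0 ∧ G.d₀ a.1 = v ∨ a.2 = 1 ∧ G.d₁ a.1 = v)) (by
      rintro _ _ (e | e) <;> simp)
  have hF : F (G.vertex v) = F (G.vertex w) := congrArg F h
  exact (hF.mp rfl).symm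

namespace ColoredGraph

variable {n : ℕ}

/-- A self-equivalence of a colored graph maps every vertex to itself and every edge onto itself,
preserving the direction. -/
theorem IsEquivalence.fixes_cells {G : ColoredGraph n} {h : C(G.Space, G.Space)}
    (hh : IsEquivalence h) : (∀ v, h (G.vertex v) = G.vertex v) ∧
      ∀ e, ∃ θ : I ≃o I, ∀ t, h (G.edge e t) = G.edge e (θ t) := by
  obtain ⟨ψ, hψ⟩ := hh.vertices
  obtain ⟨φ, hφ⟩ := hh.edges
  have haut : G.IsColorAut G.base ψ φ := by
    refine ⟨G.vertex_injective ((hψ _).symm.trans hh.map_pt), fun e => ?_, fun e => ?_,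
      fun e => (hφ e).1⟩ <;>
    · obtain ⟨-, θ, hθ⟩ := hφ e
      apply G.vertex_injective
      rw [← hψ]
      -- An increasing bijection of the interval fixes `0` and `1`, so the edge map respects
      -- starting and end points separately.
      first
      | rw [← FinGraph.edge_zero, ← FinGraph.edge_zero, hθ]
        exact congrArg _ θ.map_bot
      | rw [← FinGraph.edge_one, ← FinGraph.edge_one, hθ]
        exact congrArg _ θ.map_top
  refine ⟨fun v => by rw [hψ, haut.vertex_eq G.oriented], fun e => ?_⟩
  obtain ⟨-, θ, hθ⟩ := hφ e
  rw [haut.edge_eq G.oriented] at hθ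
  exact ⟨θ, hθ⟩

/-- The straight-line homotopy from an automorphism of the interval to the identity. -/
def segment (θ : I ≃o I) : C(I × I, I) where
  toFun p := ⟨(1 - p.2 : ℝ) * θ p.1 + p.2 * p.1, convex_Icc (0 : ℝ) 1 (θ p.1).2 p.1.2
    (sub_nonneg.2 p.2.2.2) p.2.2.1 (sub_add_cancel _ _)⟩
  continuous_toFun := by
    have := θ.continuous
    fun_prop

/-- A self-equivalence of a colored graph is homotopic to the identity. -/
theorem IsEquivalence.ptHomotopic_id {G : ColoredGraph n} {h : C(G.Space, G.Space)}
    (hh : IsEquivalence h) : PtHomotopic G.pt h (ContinuousMap.id _) := by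
  obtain ⟨hv, he⟩ := hh.fixes_cells
  choose θ hθ using he
  have h₀ : ∀ e, (θ e 0 : I) = 0 := fun e => (θ e).map_bot
  have h₁ : ∀ e, (θ e 1 : I) = 1 := fun e => (θ e).map_top
  -- The homotopy is built as a map into the path space, so that it can be glued cell by cell with
  -- `FinGraph.lift`.
  let L : C(G.Space, C(I, G.Space)) := FinGraph.lift
    (fun v => ContinuousMap.const I (G.vertex v))
    (fun e => ((G.edge e).comp (segment (θ e))).curry)
    (fun e => by
      ext s
      have : segment (θ e) (0, s) = 0 := Subtype.ext (by simp [segment, h₀])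
      change G.edge e (segment (θ e) (0, s)) = _
      rw [this, FinGraph.edge_zero]
      rfl)
    (fun e => by
      ext s
      have : segment (θ e) (1, s) = 1 := Subtype.ext (by simp [segment, h₁])
      change G.edge e (segment (θ e) (1, s)) = _
      rw [this, FinGraph.edge_one]
      rfl)
  refine ⟨⟨⟨⟨fun p => L p.2 p.1, ?_⟩, ?_, ?_⟩, ?_⟩⟩
  · exact L.uncurry.continuous.comp continuous_swap
  · refine FinGraph.space_ind (fun v => (hv v).symm) fun e t => ?_
    change G.edge e (segment (θ e) (t, 0)) = _
    rw [hθ]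
    congr 1
    exact Subtype.ext (by simp [segment])
  · refine FinGraph.space_ind (fun v => rfl) fun e t => ?_
    change G.edge e (segment (θ e) (t, 1)) = G.edge e t
    congr 1
    exact Subtype.ext (by simp [segment])
  · rintro t _ rfl
    exact (hv G.base).symm

end ColoredGraph

/-! ### Stabilizers of marked graphs and of points -/

/-- An automorphism of the free group fixing a marked graph up to equivalence is the identity. -/
theorem MarkedGraph.eq_one_of_equivalent {n : ℕ} {a : MarkedGraph n}
    {f : MulAut (FreeGroup (Fin n))} (h : (a.precomp f).Equivalent a) : f = 1 := by
  obtain ⟨h, hh, hμ⟩ := h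
  have hid : PtHomotopic (rose n).pt (a.marking.comp (roseSelfMap f.toMonoidHom)) a.marking := by
    refine ContinuousMap.HomotopicRel.trans ?_ hμ
    exact (hh.ptHomotopic_id.precomp (a.marking.comp (roseSelfMap f.toMonoidHom))
      a.isPtHomotopyEquiv.1).symm
  obtain ⟨-, g, -, hg, -⟩ := a.isPtHomotopyEquiv
  have h₁ := hg.precomp (roseSelfMap f.toMonoidHom) (roseSelfMap_pt _)
  -- The homotopy inverse `g` cancels the marking on the left.
  have h₂ := (h₁.symm.trans (hid.postcomp g)).trans hg
  have := eq_id_of_roseSelfMap h₂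
  ext1 x
  exact DFunLike.congr_fun this x

/-- If a point of the realization is fixed, then so is an element of the poset. -/
theorem Realization.exists_smul_eq {P : Type*} [PartialOrder P] {M : Type*} [Group M]
    [MulAction M P] [CovariantClass M P (· • ·) (· ≤ ·)] {g : M} {x : Realization P}
    (hx : g • x = x) : ∃ p : P, g • p = p := by
  have hne : x.weight.support.Nonempty := by
    rw [Finsupp.support_nonempty_iff]
    intro h
    have := x.sum_eq_one
    rw [h, Finsupp.sum_zero_index] at this
    exact zero_ne_one this
  have hw : ∀ p, x.weight (g⁻¹ • p) = x.weight p := fun p => by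
    rw [← smul_weight, hx]
  obtain ⟨p, hp⟩ := x.weight.support.exists_minimal hne
  have hp₀ : x.weight p ≠ 0 := Finsupp.mem_support_iff.1 hp.prop
  have hp₁ : g • p ∈ x.weight.support := by
    rw [Finsupp.mem_support_iff, ← hw, inv_smul_smul]
    exact hp₀
  have hp₂ : g⁻¹ • p ∈ x.weight.support := by
    rw [Finsupp.mem_support_iff, hw]
    exact hp₀
  refine ⟨p, ?_⟩
  -- If `g • p` is not below `p`, then `g⁻¹ • p` is, and minimality of `p` applies to it instead.
  rcases x.isChain.total hp.prop hp₁ with h | h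
  · have h' : g⁻¹ • p ≤ p := by
      have := CovariantClass.elim (μ := ((· • ·) : M → P → P)) (r := (· ≤ ·)) g⁻¹ h
      simpa using this
    have := h'.antisymm (hp.le_of_le hp₂ h')
    exact (inv_smul_eq_iff.1 this).symm
  · exact h.antisymm (hp.le_of_le hp₁ h)

end AutFree

end

theorem mainTheorem10 (n : ℕ) (f : AutFree.AutFreeGroup n) (x : AutFree.XComplex n)
    (hx : f • x = x) : f = 1 := by
  obtain ⟨p, hp⟩ := AutFree.Realization.exists_smul_eq hx
  induction p using Quotient.inductionOn with
  | h a =>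
    exact MulOpposite.unop_injective
      (AutFree.MarkedGraph.eq_one_of_equivalent (Quotient.exact hp))
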